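/- \textbf{Notation.} For a locally compact group $N$ let $L^p(N)$ be taken with respect to a left Haar measure and let $\lambda(g)\xi(x)=\xi(g^{-1}x)$ be the left regular representation on $L^2(N)$. The Fourier algebra $A(N)$ is the set of all functions $u=\langle\lambda(\cdot)\xi\,|\,\eta\rangle$ with $\xi,\eta\in L^2(N)$, with the norm $\|u\|_A=\inf\{\|\xi\|_2\|\eta\|_2: u=\langle\lambda(\cdot)\xi\,|\,\eta\rangle\}$. Its dual is the group von Neumann algebra $VN(N)=\lambda(N)''\subset\mathcal B(L^2(N))$, where $T\in VN(N)$ acts by $T(u)=\langle T\xi\,|\,\eta\rangle$ for $u=\langle\lambda(\cdot)\xi\,|\,\eta\rangle$. Let $A_c(N)$ be the set of $u\in A(N)$ with compact support. A closed set $E\subseteq N$ is a \emph{set of local synthesis for $N$} if, with closures taken in $A(N)$, \[ \overline{\{u\in A_c(N):\operatorname{supp}u\cap E=\varnothing\}}=\overline{\{u\in A_c(N):u|_E=0\}}. \] \textbf{Lemma.} Let $G$ be a connected Lie group with Lie algebra $\mathfrak g$, let $0\neq X\in\mathfrak g$, so that $(X,0)$ belongs to the Lie algebra $\mathfrak g\times\mathfrak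 g$ of $G\times G$, and let $0\neq v\in L^1(G)$. Let $\mathcal D(G\times G)\subset A(G\times G)$ be the space of compactly supported smooth complex functions on $G\times G$, and for $u\in\mathcal D(G\times G)$ put \[ \partial_{(X,0)}u(g,h)=\frac{d}{dt}\Big|_{t=0}u(g\exp(tX),h). \] If there is $S\in VN(G\times G)$ such that \[ S(u)=\int_G \partial_{(X,0)}u(g,g^{-1})\,v(g)\,dg\qquad\text{for all }u\in\mathcal D(G\times G), \] then the anti-diagonal $\check\Delta_G=\{(g,g^{-1}):g\in G\}$ is not a set of local synthesis for $G\times G$. -/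

import Mathlib

open MeasureTheory
open scoped Manifold ContDiff ENNReal

noncomputable section

/-- The Hilbert space `L²(G)` of a group with respect to a (left Haar) measure `μ`. -/
abbrev L2 {G : Type*} [MeasurableSpace G] (μ : Measure G) : Type _ := Lp ℂ 2 μ

section FourierAlgebra

variable {G : Type*} [Group G] [MeasurableSpace G] [MeasurableMul G]
  (μ : Measure G) [μ.IsMulLeftInvariant]

/-- The left regular representation: `(λ(g) ξ)(x) = ξ(g⁻¹ x)` for `ξ ∈ L²(G)`. -/
def leftRegular (g : G) : L2 μ →L[ℂ] L2 μ :=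
  (Lp.compMeasurePreservingₗᵢ ℂ (fun x : G => g⁻¹ * x)
    (measurePreserving_mul_left μ g⁻¹)).toContinuousLinearMap

/-- The underlying set of the group von Neumann algebra `VN(G) = λ(G)''`: the double commutant of
the left regular representation in the bounded operators on `L²(G)`. -/
def groupVN : Set (L2 μ →L[ℂ] L2 μ) :=
  Set.centralizer (Set.centralizer (Set.range (leftRegular μ)))

variable {μ} in
/-- The matrix coefficient `g ↦ ⟨λ(g) ξ | η⟩`, linear in `ξ` and conjugate linear in `η`
(Mathlib's inner product is conjugate linear in its first argument). -/
def coefficient (ξ η : L2 μ) : G → ℂ := fun g => inner ℂ η (leftRegular μ g ξ)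

/-- The Fourier algebra `A(G)`: all matrix coefficients of the left regular representation. -/
def fourierAlgebra : Set (G → ℂ) := {u | ∃ ξ η : L2 μ, u = coefficient ξ η}

/-- The norm of `A(G)`, `‖u‖ = inf {‖ξ‖ ‖η‖ : u = ⟨λ(·) ξ | η⟩}`, with the value `∞` for functions
that do not belong to `A(G)`. -/
def fourierNorm (u : G → ℂ) : ℝ≥0∞ :=
  ⨅ (ξ : L2 μ) (η : L2 μ) (_ : u = coefficient ξ η), ‖ξ‖ₑ * ‖η‖ₑ

/-- The closure in `A(G)`, for its norm, of a set of functions. -/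
def fourierClosure (K : Set (G → ℂ)) : Set (G → ℂ) :=
  {u | u ∈ fourierAlgebra μ ∧ ∀ ε : ℝ≥0∞, 0 < ε → ∃ w ∈ K, fourierNorm μ (u - w) < ε}

variable [TopologicalSpace G]

/-- `A_c(G)`: the elements of `A(G)` with compact support. -/
def fourierAc : Set (G → ℂ) := {u | u ∈ fourierAlgebra μ ∧ HasCompactSupport u}

/-- `I_G(E)`: the elements of `A(G)` that vanish on `E`. -/
def vanishingIdeal (E : Set G) : Set (G → ℂ) := {u | u ∈ fourierAlgebra μ ∧ ∀ g ∈ E, u g = 0}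

/-- `I_G⁰(E)`: the elements of `A_c(G)` whose (closed) support is disjoint from `E`. -/
def smallIdeal (E : Set G) : Set (G → ℂ) := {u | u ∈ fourierAc μ ∧ tsupport u ∩ E = ∅}

/-- `J_G(E)`: the closure of `I_G(E) ∩ A_c(G)` in `A(G)`. -/
def localIdeal (E : Set G) : Set (G → ℂ) := fourierClosure μ (vanishingIdeal μ E ∩ fourierAc μ)

/-- The (closed) set `E` is a set of local synthesis for `G`: the closure of `I_G⁰(E)` in `A(G)` is
`J_G(E)`. -/
def IsLocalSynthesisSet (E : Set G) : Prop := fourierClosure μ (smallIdeal μ E) = localIdeal μ E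

end FourierAlgebra

/-- The anti-diagonal `{(g, g⁻¹) : g ∈ G}` in `G × G`. -/
def antidiagonalSet (G : Type*) [Group G] : Set (G × G) := Set.range fun g : G => (g, g⁻¹)

section LieGroup

variable {E : Type*} [NormedAddCommGroup E] [NormedSpace ℝ E]
  {H : Type*} [TopologicalSpace H] (I : ModelWithCorners ℝ E H)
  {G : Type*} [TopologicalSpace G] [ChartedSpace H G]

/-- The test functions `𝓓(G)`: smooth compactly supported complex functions. -/
def IsTestFunction (u : G → ℂ) : Prop := ContMDiff I 𝓘(ℝ, ℂ) ∞ u ∧ HasCompactSupport u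

/-- The derivative `∂_X u(g) = d/dt u(g exp(tX))` at `t = 0`, for `X` in the Lie algebra
(the tangent space at `1`): the derivative of `u` along the left-invariant vector field whose
value at `1` is `X`, that is, along the velocity at `t = 0` of the curve `t ↦ g exp(tX)`. -/
def lieDeriv [Group G] (X : GroupLieAlgebra I G) (u : G → ℂ) (g : G) : ℂ :=
  mfderiv I 𝓘(ℝ, ℂ) u g (mulInvariantVectorField X g)

end LieGroup

/-- The element `(X, 0)` of the Lie algebra of `G × G`, for `X` in the Lie algebra of `G`. -/
def lieInl {E : Type*} [NormedAddCommGroup E] [NormedSpace ℝ E]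
    {H : Type*} [TopologicalSpace H] (I : ModelWithCorners ℝ E H)
    {G : Type*} [TopologicalSpace G] [ChartedSpace H G] [Group G]
    (X : GroupLieAlgebra I G) : GroupLieAlgebra (I.prod I) (G × G) :=
  ((X, 0) : E × E)

end

/-! Assume local synthesis; the aim is `v = 0`. The functional of `S` kills smooth elements of `I⁰`
of the anti-diagonal, since `∂_{(X,0)}u` vanishes off the support of `u`. Mollifying one vector of a
coefficient extends this to all of `I⁰` (`inner_eq_zero_of_mem_smallIdeal`). Synthesis and
continuity of `S` on `A(G × G)` then show that `S` kills every `u ∈ A_c` vanishing on the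
anti-diagonal (`inner_eq_zero_of_isLocalSynthesisSet`). Continuity requires that `⟨Sξ|η⟩` depend
only on the coefficient; this is where `S ∈ VN` enters, through the amplification argument of the
bicommutant theorem.

The functions `u(g,h) = p(g)q(h⁻¹) - q(g)p(h⁻¹)` vanish on the anti-diagonal, but their derivative
along `(X,0)` there is the Wronskian `W(p,q) = (∂p)q - (∂q)p`. Hence `∫ W(p,q) v = 0` whenever `u`
lies in `A_c`. To have explicit elements of `A_c`, `p` and `q` are taken to be two-sided averages of
test functions `P`, `Q` (`wedge_smear_mem_fourierAc`). Shrinking the averaging kernel gives `∫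
W(P,Q) v = 0` for all test functions.

Finally `W(PR,Q) - W(P,QR) = 2PQ ∂R`, so `Q (∂R) v = 0` almost everywhere. As `X ≠ 0`, near any
point some `R` has `∂R ≠ 0`, whence `v = 0`. -/

theorem nonpos_of_forall_pos_le_mul {a b : ℝ} (h : ∀ ε : ℝ, 0 < ε → a ≤ ε * b) : a ≤ 0 := by
  have h0 : Filter.Tendsto (fun ε : ℝ => ε * b) (nhdsWithin 0 (Set.Ioi 0)) (nhds (0 * b)) :=
    ((continuous_id.mul continuous_const).tendsto 0).mono_left nhdsWithin_le_nhds
  rw [zero_mul] at h0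
  exact ge_of_tendsto h0 (eventually_mem_nhdsWithin.mono h)

/-! ### Bicommutants and amplification to finite direct sums. -/

section Amplification

variable {H ι : Type*} [NormedAddCommGroup H] [InnerProductSpace ℂ H] [Fintype ι]

/-- The diagonal operator `T ⊕ ⋯ ⊕ T` on a finite direct sum of copies of a Hilbert space. -/
noncomputable def amplify (ι : Type*) [Fintype ι] (T : H →L[ℂ] H) :
    PiLp 2 (fun _ : ι => H) →L[ℂ] PiLp 2 (fun _ : ι => H) :=
  (PiLp.continuousLinearEquiv 2 ℂ (fun _ : ι => H)).symm.toContinuousLinearMap ∘L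
    ContinuousLinearMap.pi fun i => T ∘L PiLp.proj 2 (fun _ : ι => H) i

@[simp] theorem amplify_apply (T : H →L[ℂ] H) (x : PiLp 2 (fun _ : ι => H)) (i : ι) :
    amplify ι T x i = T (x i) := rfl

theorem inner_amplify_left [CompleteSpace H] (T : H →L[ℂ] H) (x y : PiLp 2 (fun _ : ι => H)) :
    inner ℂ (amplify ι (ContinuousLinearMap.adjoint T) x) y = inner ℂ x (amplify ι T y) := by
  simp [PiLp.inner_apply, ContinuousLinearMap.adjoint_inner_left]

/-- An operator on the direct sum is a matrix of operators on `H`; commuting with diagonal operators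
can be tested entry by entry. -/
theorem mem_centralizer_component {𝒰 : Set (H →L[ℂ] H)}
    {P : PiLp 2 (fun _ : ι => H) →L[ℂ] PiLp 2 (fun _ : ι => H)}
    (hP : ∀ T ∈ 𝒰, ∀ x, P (amplify ι T x) = amplify ι T (P x)) [DecidableEq ι] (i j : ι) :
    PiLp.proj 2 (fun _ : ι => H) i ∘L P ∘L
      (PiLp.continuousLinearEquiv 2 ℂ (fun _ : ι => H)).symm.toContinuousLinearMap ∘L
        ContinuousLinearMap.single ℂ (fun _ : ι => H) j ∈ Set.centralizer 𝒰 := by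
  intro T hT
  ext h
  have hs : WithLp.toLp 2 (Pi.single j (T h)) =
      amplify ι T (WithLp.toLp 2 (Pi.single j h)) := by
    ext k
    by_cases hk : k = j
    · subst hk; simp
    · simp [hk]
  have := congrArg (fun z => z i) (hP T hT (WithLp.toLp 2 (Pi.single j h)))
  simp only [amplify_apply] at this
  simpa [hs] using this.symm

/-- The matrix entries of `P` lie in the commutant of `𝒰`, so `S` commutes with each of them. -/
theorem comm_amplify_of_mem_bicentralizer {𝒰 : Set (H →L[ℂ] H)}
    {P : PiLp 2 (fun _ : ι => H) →L[ℂ] PiLp 2 (fun _ : ι => H)}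
    (hP : ∀ T ∈ 𝒰, ∀ x, P (amplify ι T x) = amplify ι T (P x))
    {S : H →L[ℂ] H} (hS : S ∈ Set.centralizer (Set.centralizer 𝒰))
    (x : PiLp 2 (fun _ : ι => H)) : P (amplify ι S x) = amplify ι S (P x) := by
  classical
  have hsum : ∀ y : PiLp 2 (fun _ : ι => H),
      y = ∑ j, WithLp.toLp 2 (Pi.single j (y j)) := by
    intro y
    rw [← WithLp.toLp_sum, Finset.univ_sum_single]
  ext i
  rw [amplify_apply]
  conv_lhs => rw [hsum (amplify ι S x)]
  conv_rhs => rw [hsum x]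
  simp only [map_sum, amplify_apply, WithLp.ofLp_sum, Finset.sum_apply]
  refine Finset.sum_congr rfl fun j _ => ?_
  have := congrArg (fun A : H →L[ℂ] H => A (x j)) (hS _ (mem_centralizer_component hP i j))
  simpa using this

/-- Finite sums of vector functionals vanishing on a self-adjoint multiplicative set of operators
that contains the identity vanish on its bicommutant. -/
theorem sum_inner_eq_zero_of_mem_bicentralizer [CompleteSpace H] {𝒰 : Set (H →L[ℂ] H)}
    (h1 : 1 ∈ 𝒰) (hmul : ∀ T ∈ 𝒰, ∀ T' ∈ 𝒰, T * T' ∈ 𝒰)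
    (hadj : ∀ T ∈ 𝒰, ContinuousLinearMap.adjoint T ∈ 𝒰)
    {S : H →L[ℂ] H} (hS : S ∈ Set.centralizer (Set.centralizer 𝒰)) (ξ η : ι → H)
    (h : ∀ T ∈ 𝒰, ∑ i, inner ℂ (η i) (T (ξ i)) = 0) :
    ∑ i, inner ℂ (η i) (S (ξ i)) = 0 := by
  set x : PiLp 2 (fun _ : ι => H) := WithLp.toLp 2 ξ with hx
  set y : PiLp 2 (fun _ : ι => H) := WithLp.toLp 2 η with hy
  -- `M` is the closed cyclic subspace generated by `x`. Its projection commutes with the amplified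
  -- `𝒰`, hence with the amplified `S`, so the amplified `S` maps `x` into `M`; the hypothesis says
  -- `M ⊥ y`.
  set M₀ : Submodule ℂ (PiLp 2 (fun _ : ι => H)) :=
    Submodule.span ℂ ((fun T => amplify ι T x) '' 𝒰) with hM₀
  set M := M₀.topologicalClosure with hM
  have : CompleteSpace M := M₀.isClosed_topologicalClosure.completeSpace_coe
  have hinv : ∀ T ∈ 𝒰, ∀ z ∈ M, amplify ι T z ∈ M := by
    intro T hT z hz
    have h0 : M₀ ≤ M.comap (amplify ι T).toLinearMap := by
      rw [hM₀, Submodule.span_le]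
      rintro _ ⟨T', hT', rfl⟩
      exact M₀.le_topologicalClosure (Submodule.subset_span ⟨T * T', hmul T hT T' hT', rfl⟩)
    have hcl : IsClosed (M.comap (amplify ι T).toLinearMap : Set (PiLp 2 (fun _ : ι => H))) :=
      M₀.isClosed_topologicalClosure.preimage (amplify ι T).continuous
    exact M₀.topologicalClosure_minimal h0 hcl hz
  have hcomm : ∀ T ∈ 𝒰, ∀ z, M.starProjection (amplify ι T z) =
      amplify ι T (M.starProjection z) := by
    intro T hT z
    refine Submodule.eq_starProjection_of_mem_orthogonal (hinv T hT _ (M.starProjection_apply_mem z)) ?_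
    rw [← map_sub, Submodule.mem_orthogonal]
    intro m hm
    rw [← inner_amplify_left]
    exact (Submodule.mem_orthogonal _ _).1 (M.sub_starProjection_mem_orthogonal z) _
      (hinv _ (hadj T hT) m hm)
  have hxM : x ∈ M := M₀.le_topologicalClosure (Submodule.subset_span ⟨1, h1, rfl⟩)
  have hSx : amplify ι S x ∈ M := by
    rw [← Submodule.starProjection_eq_self_iff, comm_amplify_of_mem_bicentralizer hcomm hS,
      Submodule.starProjection_eq_self_iff.2 hxM]
  have hyM : M ≤ (ℂ ∙ y)ᗮ := by
    refine M₀.topologicalClosure_minimal ?_ (Submodule.isClosed_orthogonal _)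
    rw [hM₀, Submodule.span_le]
    rintro _ ⟨T, hT, rfl⟩
    rw [SetLike.mem_coe, Submodule.mem_orthogonal_singleton_iff_inner_right]
    simpa [PiLp.inner_apply] using h T hT
  have := Submodule.mem_orthogonal_singleton_iff_inner_right.1 (hyM hSx)
  simpa [PiLp.inner_apply] using this

end Amplification

/-! ### The left regular representation and the pairing of `VN` with coefficients. -/

section GroupVN

variable {N : Type*} [Group N] [MeasurableSpace N] [MeasurableMul N]
  (ν : Measure N) [ν.IsMulLeftInvariant]

theorem leftRegular_ae (g : N) (ξ : L2 ν) : leftRegular ν g ξ =ᵐ[ν] fun x => ξ (g⁻¹ * x) :=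
  Lp.coeFn_compMeasurePreserving _ (measurePreserving_mul_left ν g⁻¹)

theorem leftRegular_one : leftRegular ν (1 : N) = 1 := by
  ext1 ξ
  apply Lp.ext
  filter_upwards [leftRegular_ae ν 1 ξ] with x hx
  simpa using hx

theorem leftRegular_mul (g h : N) : leftRegular ν (g * h) = leftRegular ν g * leftRegular ν h := by
  ext1 ξ
  apply Lp.ext
  filter_upwards [leftRegular_ae ν (g * h) ξ, leftRegular_ae ν g (leftRegular ν h ξ),
    (measurePreserving_mul_left ν g⁻¹).quasiMeasurePreserving.ae (leftRegular_ae ν h ξ)]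
    with x h1 h2 h3
  rw [h1, mul_apply_eq_comp, h2, h3, mul_inv_rev, mul_assoc]

theorem inner_leftRegular_leftRegular (g : N) (ξ η : L2 ν) :
    inner ℂ (leftRegular ν g ξ) (leftRegular ν g η) = inner ℂ ξ η :=
  (Lp.compMeasurePreservingₗᵢ ℂ (fun x : N => g⁻¹ * x)
    (measurePreserving_mul_left ν g⁻¹)).inner_map_map ξ η

theorem adjoint_leftRegular (g : N) :
    ContinuousLinearMap.adjoint (leftRegular ν g) = leftRegular ν g⁻¹ := by
  symm
  rw [ContinuousLinearMap.eq_adjoint_iff]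
  intro ξ η
  rw [← inner_leftRegular_leftRegular ν g, ← mul_apply_eq_comp, ← leftRegular_mul]
  simp [leftRegular_one]

variable {ν} in
-- This makes the pairing `u ↦ ⟨Sξ|η⟩` well defined and additive on coefficients. The translations
-- form a self-adjoint multiplicative set, so the bicommutant argument applies.
theorem sum_inner_eq_zero_of_sum_coefficient_eq_zero {ι : Type*} [Fintype ι]
    {S : L2 ν →L[ℂ] L2 ν} (hS : S ∈ groupVN ν) (ξ η : ι → L2 ν)
    (h : ∑ i, coefficient (ξ i) (η i) = 0) : ∑ i, inner ℂ (η i) (S (ξ i)) = 0 := by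
  refine sum_inner_eq_zero_of_mem_bicentralizer (𝒰 := Set.range (leftRegular ν))
    ⟨1, leftRegular_one ν⟩ ?_ ?_ hS ξ η ?_
  · rintro _ ⟨g, rfl⟩ _ ⟨g', rfl⟩
    exact ⟨g * g', leftRegular_mul ν g g'⟩
  · rintro _ ⟨g, rfl⟩
    exact ⟨g⁻¹, (adjoint_leftRegular ν g).symm⟩
  · rintro _ ⟨g, rfl⟩
    simpa [coefficient] using congrFun h g

end GroupVN

/-! ### Smooth dependence of integrals on a parameter. -/

section ParametricIntegral

theorem MeasureTheory.Integrable.mul_continuous_of_hasCompactSupport {S : Type*}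
    [TopologicalSpace S] [T2Space S] [MeasurableSpace S] [BorelSpace S] {ν : Measure S}
    {θ h : S → ℂ} (hθ : Integrable θ ν) (hc : HasCompactSupport θ) (hh : Continuous h) :
    Integrable (fun s => θ s * h s) ν := by
  rw [← integrableOn_iff_integrable_of_support_subset (s := tsupport θ)]
  · exact hθ.integrableOn.mul_continuousOn hh.continuousOn hc
  · intro s hs
    exact subset_tsupport _ (left_ne_zero_of_mul hs)

/-- The integral is the value at `0` of a convolution of `κ` with a parameter-dependent kernel, to
which smoothness of convolutions applies. -/
theorem contDiffOn_integral_mul_of_isCompact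
    {E₁ E₂ : Type*} [NormedAddCommGroup E₁] [NormedSpace ℝ E₁]
    [NormedAddCommGroup E₂] [NormedSpace ℝ E₂] [FiniteDimensional ℝ E₂]
    [MeasurableSpace E₂] [BorelSpace E₂] (m : Measure E₂) {F : E₁ × E₂ → ℂ} {κ : E₂ → ℂ}
    {U : Set E₁} {V A : Set E₂} (hU : IsOpen U) (hV : IsOpen V) (hA : IsCompact A) (hAV : A ⊆ V)
    (hF : ContDiffOn ℝ ∞ F (U ×ˢ V)) (hm : ∀ᵐ y ∂m, y ∈ A) (hκ : Integrable κ m) :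
    ContDiffOn ℝ ∞ (fun x => ∫ y, κ y * F (x, y) ∂m) U := by
  obtain ⟨W, hW, hAW, hWV, hWc⟩ := exists_open_between_and_isCompact_closure hA hV hAV
  obtain ⟨χ, hχ, -, hχs, hχ1⟩ := exists_contMDiff_support_eq_eq_one_iff 𝓘(ℝ, E₂) (n := ⊤)
    hW hA.isClosed hAW
  replace hχ : ContDiff ℝ ∞ χ := contMDiff_iff_contDiff.1 hχ
  have hts : tsupport χ ⊆ V := by rwa [tsupport, hχs]
  -- The reflection turns evaluation of the convolution at `0` into `∫ κ(y) F(x,y)`; the cutoff `χ`,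
  -- equal to `1` on `A`, makes the kernel globally smooth with compact support in `z`.
  set g : E₁ → E₂ → ℂ := fun x z => χ (-z) • F (x, -z) with hg
  have hgs : ContDiffOn ℝ ∞ (↿g) (U ×ˢ Set.univ) := by
    rintro ⟨x, z⟩ ⟨hx, -⟩
    by_cases hz : -z ∈ V
    · have h1 : ContDiffAt ℝ ∞ F (x, -z) :=
        hF.contDiffAt ((hU.prod hV).mem_nhds ⟨hx, hz⟩)
      have h2 : ContDiffAt ℝ ∞ (fun p : E₁ × E₂ => (p.1, -p.2)) (x, z) :=
        contDiffAt_fst.prodMk contDiffAt_snd.neg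
      exact ((hχ.contDiffAt.comp (x, z) contDiffAt_snd.neg).smul
        (h1.comp (x, z) h2)).contDiffWithinAt
    · have h0 : ∀ᶠ p : E₁ × E₂ in nhds (x, z), -p.2 ∉ tsupport χ := by
        have : IsOpen {p : E₁ × E₂ | -p.2 ∉ tsupport χ} :=
          (isClosed_tsupport χ).isOpen_compl.preimage continuous_snd.neg
        exact this.mem_nhds fun h => hz (hts h)
      refine (contDiffAt_const (c := (0 : ℂ))).congr_of_eventuallyEq ?_ |>.contDiffWithinAt
      filter_upwards [h0] with p hp
      change χ (-p.2) • F (p.1, -p.2) = 0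
      rw [image_eq_zero_of_notMem_tsupport hp, zero_smul]
  have key := contDiffOn_convolution_right_with_param (ContinuousLinearMap.mul ℝ ℂ) (n := ⊤)
    (μ := m) (f := κ) (g := g) (k := -closure W) hU hWc.neg ?_ hκ.locallyIntegrable hgs
  · have h2 : ContDiffOn ℝ ∞ (fun x : E₁ => (x, (0 : E₂))) U := by fun_prop
    refine (key.comp h2 fun x hx => ⟨hx, trivial⟩).congr fun x _ => ?_
    simp only [Function.comp_apply, convolution, ContinuousLinearMap.mul_apply']
    refine integral_congr_ae ?_
    filter_upwards [hm] with y hy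
    simp [hg, (hχ1 y).1 hy]
  · intro x z _ hz
    have : χ (-z) = 0 := image_eq_zero_of_notMem_tsupport fun h => hz (by
      rw [tsupport, hχs] at h
      exact h)
    simp [hg, this]

variable {E₁ H₁ M E₂ H₂ S : Type*}
  [NormedAddCommGroup E₁] [NormedSpace ℝ E₁] [TopologicalSpace H₁]
  {I : ModelWithCorners ℝ E₁ H₁} [TopologicalSpace M] [ChartedSpace H₁ M] [I.Boundaryless]
  [IsManifold I ∞ M]
  [NormedAddCommGroup E₂] [NormedSpace ℝ E₂] [FiniteDimensional ℝ E₂] [TopologicalSpace H₂]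
  {J : ModelWithCorners ℝ E₂ H₂} [TopologicalSpace S] [ChartedSpace H₂ S] [J.Boundaryless]
  [IsManifold J ∞ S] [MeasurableSpace S] [BorelSpace S]

/-- Pushing the restricted measure forward along the chart reduces this to the vector space case;
that case allows any measure concentrated on a compact set, so no density is needed. -/
theorem contMDiffAt_setIntegral_mul_of_subset_chart (ν : Measure S) {f : M × S → ℂ}
    (hf : ContMDiff (I.prod J) 𝓘(ℝ, ℂ) ∞ f) {θ : S → ℂ} (hθ : Integrable θ ν) (m₀ : M) (s₀ : S)
    {A B : Set S} (hA : IsCompact A) (hAs : A ⊆ (chartAt H₂ s₀).source) (hB : MeasurableSet B)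
    (hBA : B ⊆ A) : ContMDiffAt I 𝓘(ℝ, ℂ) ∞ (fun m => ∫ s in B, θ s * f (m, s) ∂ν) m₀ := by
  borelize E₂
  set e := extChartAt J s₀ with he
  set e₁ := extChartAt I m₀ with he₁
  have hAs' : A ⊆ e.source := by rwa [he, extChartAt_source]
  have hBs : B ⊆ e.source := hBA.trans hAs'
  have heB : AEMeasurable e (ν.restrict B) :=
    ((continuousOn_extChartAt s₀).mono hBs).aemeasurable hB
  set n := (ν.restrict B).map e with hn
  have hnA : ∀ᵐ y ∂n, y ∈ e '' A := by
    have hc : IsClosed (e '' A) :=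
      (hA.image_of_continuousOn ((continuousOn_extChartAt s₀).mono hAs')).isClosed
    refine (ae_map_iff heB (p := (· ∈ e '' A)) hc.measurableSet).2 ?_
    filter_upwards [ae_restrict_mem hB] with s hs using ⟨s, hBA hs, rfl⟩
  have hAt : e '' A ⊆ e.target := by
    rintro _ ⟨s, hs, rfl⟩
    exact e.map_source (hAs' hs)
  have hsymm : AEMeasurable e.symm n := by
    have h1 : n.restrict e.target = n :=
      Measure.restrict_eq_self_of_ae_mem (hnA.mono fun y hy => hAt hy)
    rw [← h1]
    exact (continuousOn_extChartAt_symm s₀).aemeasurable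
      (isOpen_extChartAt_target s₀).measurableSet
  have hmap : n.map e.symm = ν.restrict B := by
    rw [hn, AEMeasurable.map_map_of_aemeasurable hsymm heB]
    conv_rhs => rw [← Measure.map_id (μ := ν.restrict B)]
    refine Measure.map_congr ?_
    filter_upwards [ae_restrict_mem hB] with s hs using e.left_inv (hBs hs)
  have hθB : Integrable θ (n.map e.symm) := hmap ▸ hθ.integrableOn
  have hF : ContDiffOn ℝ ∞ (fun p : E₁ × E₂ => f (e₁.symm p.1, e.symm p.2))
      (e₁.target ×ˢ e.target) := by
    rw [← contMDiffOn_iff_contDiffOn]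
    refine hf.comp_contMDiffOn (ContMDiffOn.prodMk ?_ ?_)
    · exact (contMDiffOn_extChartAt_symm m₀).comp contDiffOn_fst.contMDiffOn fun p hp => hp.1
    · exact (contMDiffOn_extChartAt_symm s₀).comp contDiffOn_snd.contMDiffOn fun p hp => hp.2
  have key := contDiffOn_integral_mul_of_isCompact n (isOpen_extChartAt_target m₀)
    (isOpen_extChartAt_target s₀)
    (hA.image_of_continuousOn ((continuousOn_extChartAt s₀).mono hAs')) hAt hF hnA
    ((integrable_map_measure hθB.aestronglyMeasurable hsymm).1 hθB)
  have hint : ∀ m, ∫ s in B, θ s * f (m, s) ∂ν =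
      ∫ y, θ (e.symm y) * f (m, e.symm y) ∂n := by
    intro m
    rw [← hmap, integral_map hsymm]
    exact hθB.aestronglyMeasurable.mul
      (hf.continuous.comp (by fun_prop : Continuous fun s => (m, s))).aestronglyMeasurable
  have h1 : ContMDiffAt 𝓘(ℝ, E₁) 𝓘(ℝ, ℂ) ∞
      (fun x => ∫ y, θ (e.symm y) * f (e₁.symm x, e.symm y) ∂n) (e₁ m₀) :=
    (key.contDiffAt (extChartAt_target_mem_nhds m₀)).contMDiffAt
  refine (h1.comp m₀ contMDiffAt_extChartAt).congr_of_eventuallyEq ?_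
  filter_upwards [extChartAt_source_mem_nhds (I := I) m₀] with m hm
  simp only [Function.comp_apply]
  rw [hint, e₁.left_inv hm]

/-- Integrals depending smoothly on a parameter, against a compactly supported weight, are smooth. -/
theorem contMDiff_integral_mul [T2Space S] [LocallyCompactSpace S] (ν : Measure S) {f : M × S → ℂ}
    (hf : ContMDiff (I.prod J) 𝓘(ℝ, ℂ) ∞ f) {θ : S → ℂ} (hθ : Integrable θ ν)
    (hc : HasCompactSupport θ) :
    ContMDiff I 𝓘(ℝ, ℂ) ∞ (fun m => ∫ s, θ s * f (m, s) ∂ν) := by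
  intro m₀
  have hint : ∀ m, Integrable (fun s => θ s * f (m, s)) ν := fun m =>
    hθ.mul_continuous_of_hasCompactSupport hc
      (hf.continuous.comp (by fun_prop : Continuous fun s => (m, s)))
  -- Quantifying over all measurable `B ⊆ A'` lets a union be cut into disjoint pieces, replacing a
  -- partition of unity in the compactness induction.
  let p : Set S → Prop := fun A => ∃ A', A ⊆ A' ∧ MeasurableSet A' ∧ ∀ B ⊆ A', MeasurableSet B →
    ContMDiffAt I 𝓘(ℝ, ℂ) ∞ (fun m => ∫ s in B, θ s * f (m, s) ∂ν) m₀
  have hp : p (tsupport θ) := by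
    refine hc.isCompact.induction_on (p := p) ⟨∅, subset_rfl, .empty, ?_⟩ ?_ ?_ ?_
    · intro B hB _
      simp only [Set.subset_empty_iff.1 hB, setIntegral_empty, contMDiffAt_const]
    · rintro A A₁ h ⟨A', h1, h2⟩
      exact ⟨A', h.trans h1, h2⟩
    · rintro A₁ A₂ ⟨A₁', h1, hm1, h1'⟩ ⟨A₂', h2, hm2, h2'⟩
      refine ⟨A₁' ∪ A₂', Set.union_subset_union h1 h2, hm1.union hm2, fun B hB hBm => ?_⟩
      have e1 := h1' (B ∩ A₁') Set.inter_subset_right (hBm.inter hm1)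
      have e2 := h2' (B \ A₁') (fun s hs => (hB hs.1).resolve_left hs.2) (hBm.diff hm1)
      refine (e1.add e2).congr_of_eventuallyEq (.of_forall fun m => ?_)
      exact (integral_inter_add_sdiff hm1 (hint m).integrableOn).symm
    · intro s₀ _
      obtain ⟨A, hA, hAs, hAc⟩ := local_compact_nhds
        ((chartAt H₂ s₀).open_source.mem_nhds (mem_chart_source H₂ s₀))
      exact ⟨A, mem_nhdsWithin_of_mem_nhds hA, A, subset_rfl, hAc.measurableSet, fun B hBA hB =>
        contMDiffAt_setIntegral_mul_of_subset_chart ν hf hθ m₀ s₀ hAc hAs hB hBA⟩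
  obtain ⟨A', h1, -, h2⟩ := hp
  refine (h2 _ h1 (isClosed_tsupport θ).measurableSet).congr_of_eventuallyEq
    (.of_forall fun m => ?_)
  refine (setIntegral_eq_integral_of_forall_compl_eq_zero fun s hs => ?_).symm
  rw [image_eq_zero_of_notMem_tsupport hs, zero_mul]

end ParametricIntegral

/-! ### Mollifying coefficients. -/

section Mollification

open scoped Topology Pointwise

theorem continuous_leftRegular {N : Type*} [TopologicalSpace N] [Group N] [IsTopologicalGroup N]
    [T2Space N] [LocallyCompactSpace N] [SecondCountableTopology N] [MeasurableSpace N]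
    [BorelSpace N] (ν : Measure N) [ν.IsHaarMeasure] (ξ : L2 ν) :
    Continuous fun g => leftRegular ν g ξ := by
  refine Continuous.compMeasurePreservingLp (f := fun _ : N => ξ)
    (g := fun g => ⟨fun x => g⁻¹ * x, continuous_const_mul _⟩) continuous_const ?_
    (fun g => measurePreserving_mul_left ν g⁻¹) (by simp)
  exact ContinuousMap.continuous_of_continuous_uncurry _
    (by fun_prop : Continuous fun p : N × N => p.1⁻¹ * p.2)

theorem continuous_coefficient {N : Type*} [TopologicalSpace N] [Group N] [IsTopologicalGroup N]
    [T2Space N] [LocallyCompactSpace N] [SecondCountableTopology N] [MeasurableSpace N]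
    [BorelSpace N] {ν : Measure N} [ν.IsHaarMeasure] (ξ η : L2 ν) :
    Continuous (coefficient ξ η) :=
  continuous_const.inner (continuous_leftRegular ν ξ)

theorem norm_integral_smul_sub_le {N F : Type*} [MeasurableSpace N] [NormedAddCommGroup F] [NormedSpace ℝ F]
    [CompleteSpace F] {ν : Measure N} {φ : N → ℝ} (h0 : ∀ x, 0 ≤ φ x) (h1 : ∫ x, φ x ∂ν = 1)
    {f : N → F} (hf : Integrable (fun x => φ x • f x) ν) (c : F) {ε : ℝ}
    (h : ∀ x ∈ Function.support φ, ‖f x - c‖ ≤ ε) : ‖(∫ x, φ x • f x ∂ν) - c‖ ≤ ε := by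
  have hφ : Integrable φ ν := .of_integral_ne_zero (by simp [h1])
  have e1 : (∫ x, φ x • f x ∂ν) - c = ∫ x, φ x • (f x - c) ∂ν := by
    simp_rw [smul_sub]
    rw [integral_sub hf (hφ.smul_const c), integral_smul_const, h1, one_smul]
  rw [e1]
  calc ‖∫ x, φ x • (f x - c) ∂ν‖ ≤ ∫ x, φ x * ε ∂ν := by
        refine norm_integral_le_of_norm_le (hφ.mul_const ε) (.of_forall fun x => ?_)
        rw [norm_smul, Real.norm_of_nonneg (h0 x)]
        by_cases hx : φ x = 0
        · simp [hx]
        · exact mul_le_mul_of_nonneg_left (h x hx) (h0 x)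
    _ = ε := by rw [integral_mul_const, h1, one_mul]

variable {E H N : Type*} [NormedAddCommGroup E] [NormedSpace ℝ E] [FiniteDimensional ℝ E]
  [TopologicalSpace H] (I : ModelWithCorners ℝ E H)
  [TopologicalSpace N] [Group N] [ChartedSpace H N]
  [T2Space N] [MeasurableSpace N] [BorelSpace N]

theorem exists_contMDiff_bump_integral_eq_one [IsManifold I ∞ N] (ν : Measure N)
    [IsFiniteMeasureOnCompacts ν] [ν.IsOpenPosMeasure] {V : Set N} (hV : V ∈ 𝓝 (1 : N)) :
    ∃ φ : N → ℝ, ContMDiff I 𝓘(ℝ, ℝ) ∞ φ ∧ HasCompactSupport φ ∧ tsupport φ ⊆ V ∧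
      (∀ x, 0 ≤ φ x) ∧ ∫ x, φ x ∂ν = 1 := by
  obtain ⟨f, -, hf⟩ := (SmoothBumpFunction.nhds_basis_tsupport (I := I) (1 : N)).mem_iff.1 hV
  have hpos : 0 < ∫ x, f x ∂ν :=
    f.continuous.integral_pos_of_hasCompactSupport_nonneg_nonzero f.hasCompactSupport
      (fun x => f.nonneg) (x := 1) (by simp)
  refine ⟨fun x => (∫ x, f x ∂ν)⁻¹ * f x, contMDiff_const.mul f.contMDiff,
    f.hasCompactSupport.mul_left, (tsupport_mul_subset_right).trans hf,
    fun x => mul_nonneg (inv_nonneg.2 hpos.le) f.nonneg, ?_⟩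
  rw [integral_const_mul, inv_mul_cancel₀ hpos.ne']

/-- An operator whose functional kills the smooth elements of `I⁰(C)` kills all of `I⁰(C)`. -/
theorem inner_eq_zero_of_mem_smallIdeal [I.Boundaryless] [LieGroup I ∞ N] [LocallyCompactSpace N]
    [SecondCountableTopology N] {ν : Measure N} [IsTopologicalGroup N] [ν.IsHaarMeasure]
    {C : Set N} (hC : IsClosed C) (S : L2 ν →L[ℂ] L2 ν)
    (hS : ∀ ξ η : L2 ν, IsTestFunction I (coefficient ξ η) → tsupport (coefficient ξ η) ∩ C = ∅ →
      inner ℂ η (S ξ) = 0)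
    {ξ η : L2 ν} (hu : coefficient ξ η ∈ smallIdeal ν C) : inner ℂ η (S ξ) = 0 := by
  set u := coefficient ξ η with hudef
  obtain ⟨⟨-, hK⟩, hd⟩ := hu
  have hucont : Continuous u := continuous_coefficient ξ η
  -- Mollification by `φ` supported in `V` enlarges the support of `u` at most to `V * tsupport u`,
  -- which stays off `C`.
  obtain ⟨V, hV, hVK⟩ := compact_open_separated_mul_left hK.isCompact hC.isOpen_compl
    (Set.subset_compl_iff_disjoint_right.2 (Set.disjoint_iff_inter_eq_empty.2 hd))
  have main : ∀ ε : ℝ, 0 < ε → ∃ η' : L2 ν, ‖η' - η‖ ≤ ε ∧ inner ℂ η' (S ξ) = 0 := by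
    intro ε hε
    have hV' : {s : N | ‖leftRegular ν s η - η‖ < ε} ∈ 𝓝 (1 : N) := by
      refine IsOpen.mem_nhds (isOpen_lt (((continuous_leftRegular ν η).sub
        continuous_const).norm) continuous_const) ?_
      simpa [leftRegular_one] using hε
    obtain ⟨φ, hφ, hφc, hφV, hφ0, hφ1⟩ :=
      exists_contMDiff_bump_integral_eq_one I ν (Filter.inter_mem hV hV')
    have hint : Integrable (fun s => φ s • leftRegular ν s η) ν :=
      (hφ.continuous.smul (continuous_leftRegular ν η)).integrable_of_hasCompactSupport
        hφc.smul_right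
    -- Averaging `η` alone keeps a coefficient with the same `ξ`, and replaces `u` by the
    -- convolution `φ * u`.
    set η' : L2 ν := ∫ s, φ s • leftRegular ν s η ∂ν with hη'
    have hval : ∀ g, coefficient ξ η' g = ∫ s, u s⁻¹ * (φ (g * s) : ℂ) ∂ν := by
      intro g
      calc coefficient ξ η' g = ∫ s, (φ s : ℂ) * u (s⁻¹ * g) ∂ν := by
            rw [coefficient, ← inner_conj_symm, hη', ← integral_inner hint, ← integral_conj]
            refine integral_congr_ae (.of_forall fun s => ?_)
            simp only [inner_conj_symm]
            rw [RCLike.real_smul_eq_coe_smul (K := ℂ), inner_smul_left]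
            simp only [Complex.coe_algebraMap, Complex.conj_ofReal, hudef, coefficient]
            rw [← inner_leftRegular_leftRegular ν s⁻¹, ← mul_apply_eq_comp,
              ← mul_apply_eq_comp, ← leftRegular_mul, ← leftRegular_mul]
            simp [leftRegular_one]
        -- After this translation `g` occurs only inside the smooth `φ`.
        _ = ∫ s, u s⁻¹ * (φ (g * s) : ℂ) ∂ν := by
            rw [← integral_mul_left_eq_self _ g]
            refine integral_congr_ae (.of_forall fun s => ?_)
            simp [mul_comm]
    have hsupp : Function.support (coefficient ξ η') ⊆ tsupport φ * tsupport u := by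
      intro g hg
      by_contra hn
      refine hg ?_
      rw [hval]
      refine integral_eq_zero_of_ae (.of_forall fun s => ?_)
      by_contra h
      obtain ⟨h1, h2⟩ := mul_ne_zero_iff.1 h
      exact hn ⟨g * s, subset_tsupport _ (by simpa using h2), s⁻¹, subset_tsupport _ h1, by simp⟩
    have hcpt : IsCompact (tsupport φ * tsupport u) := hφc.isCompact.mul hK.isCompact
    have htsupp : tsupport (coefficient ξ η') ⊆ tsupport φ * tsupport u :=
      closure_minimal hsupp hcpt.isClosed
    refine ⟨η', norm_integral_smul_sub_le hφ0 hφ1 hint η fun s hs => ?_, hS ξ η' ⟨?_, ?_⟩ ?_⟩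
    · exact (hφV (subset_tsupport _ hs)).2.le
    · have hf : ContMDiff (I.prod I) 𝓘(ℝ, ℂ) ∞ (fun p : N × N => (φ (p.1 * p.2) : ℂ)) :=
        (Complex.ofRealCLM.contDiff.contMDiff).comp
          (hφ.comp (contMDiff_fst.mul contMDiff_snd))
      have hcs : HasCompactSupport fun s : N => u s⁻¹ :=
        hK.comp_homeomorph (Homeomorph.inv N)
      have h := contMDiff_integral_mul ν hf
        ((hucont.comp continuous_inv).integrable_of_hasCompactSupport hcs) hcs
      exact h.congr hval
    · exact HasCompactSupport.intro hcpt fun x hx => by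
        by_contra h
        exact hx (hsupp h)
    · rw [← Set.disjoint_iff_inter_eq_empty, ← Set.subset_compl_iff_disjoint_right]
      exact htsupp.trans ((Set.mul_subset_mul_right fun s hs => (hφV hs).1).trans hVK)
  have hle : ∀ ε : ℝ, 0 < ε → ‖inner ℂ η (S ξ)‖ ≤ ε * ‖S ξ‖ := by
    intro ε hε
    obtain ⟨η', h1, h2⟩ := main ε hε
    have : inner ℂ η (S ξ) = -inner ℂ (η' - η) (S ξ) := by
      rw [inner_sub_left, h2]; simp
    rw [this, norm_neg]
    exact (norm_inner_le_norm _ _).trans (mul_le_mul_of_nonneg_right h1 (norm_nonneg _))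
  exact norm_le_zero_iff.1 (nonpos_of_forall_pos_le_mul hle)

end Mollification

/-! ### Derivatives along left-invariant vector fields. -/

section LieDerivative

open scoped Topology

variable {E H G : Type*} [NormedAddCommGroup E] [NormedSpace ℝ E]
  [TopologicalSpace H] {I : ModelWithCorners ℝ E H}
  [TopologicalSpace G] [Group G] [ChartedSpace H G]
  {E' H' S : Type*} [NormedAddCommGroup E'] [NormedSpace ℝ E']
  [TopologicalSpace H'] {J : ModelWithCorners ℝ E' H'}
  [TopologicalSpace S] [Group S] [ChartedSpace H' S]

theorem hasDerivAt_of_hasFDerivAt_comp_smulRight {F F' : Type*} [NormedAddCommGroup F]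
    [NormedSpace ℝ F] [NormedAddCommGroup F'] [NormedSpace ℝ F'] {f : ℝ → F'} {t : ℝ}
    (A : F →L[ℝ] F') (e : F)
    (h : HasFDerivAt f (A.comp (ContinuousLinearMap.smulRight (1 : ℝ →L[ℝ] ℝ) e)) t) :
    HasDerivAt f (A e) t := by
  simpa using h.hasDerivAt

/-- Local integral curves play the role of `t ↦ g exp(tX)`, reducing `∂_X` to a one-variable
derivative. -/
theorem IsMIntegralCurveAt.eventually_hasDerivAt_comp {X : GroupLieAlgebra I G} {γ : ℝ → G}
    (hγ : IsMIntegralCurveAt (I := I) γ (mulInvariantVectorField X) 0) :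
    ∀ᶠ t in 𝓝 (0 : ℝ), ∀ u : G → ℂ, MDifferentiable I 𝓘(ℝ, ℂ) u →
      HasDerivAt (fun τ => u (γ τ)) (lieDeriv I X u (γ t)) t := by
  filter_upwards [hγ] with t ht u hu
  have h := (hu.mdifferentiableAt.hasMFDerivAt (x := γ t)).comp t ht
  exact hasDerivAt_of_hasFDerivAt_comp_smulRight (F := E) (F' := ℂ) (f := fun τ => u (γ τ))
    (mfderiv I 𝓘(ℝ, ℂ) u (γ t))
    (mulInvariantVectorField X (γ t)) (hasMFDerivAt_iff_hasFDerivAt.1 h)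

variable [LieGroup I ∞ G] [LieGroup J ∞ S]

theorem lieDeriv_eq_mfderiv_comp_mul_left (X : GroupLieAlgebra I G) {u : G → ℂ}
    (hu : MDifferentiable I 𝓘(ℝ, ℂ) u) (g : G) :
    lieDeriv I X u g = mfderiv I 𝓘(ℝ, ℂ) (fun x => u (g * x)) (1 : G) X := by
  have hm : MDifferentiableAt I I (fun x : G => g * x) 1 :=
    (contMDiff_mul_left (I := I) (n := ∞) (a := g)).contMDiffAt.mdifferentiableAt (by simp)
  have h := mfderiv_comp (I' := I) (1 : G) (g := u) (f := fun x : G => g * x) hu.mdifferentiableAt hm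
  have h2 := congrArg (fun A => A X) h
  simp only [Function.comp_def] at h2
  rw [h2]
  have h3 : (mfderiv I 𝓘(ℝ, ℂ) u (g * 1) : E →L[ℝ] ℂ) = mfderiv I 𝓘(ℝ, ℂ) u g := by rw [mul_one]
  exact (congrArg (fun A : E →L[ℝ] ℂ => A (mfderiv I I (fun x : G => g * x) 1 X)) h3).symm

/-- The element `(X, 0)` of the Lie algebra of `G × S`. -/
noncomputable def lieProdInl (J : ModelWithCorners ℝ E' H') (S : Type*) [TopologicalSpace S]
    [ChartedSpace H' S] [Group S] (X : GroupLieAlgebra I G) : GroupLieAlgebra (I.prod J) (G × S) :=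
  ((X, 0) : E × E')

/-- Left translation moves both sides to the identity, where `(X, 0)` is the image of `X` under the
differential of `x ↦ (x, 1)`. -/
theorem lieDeriv_lieProdInl (X : GroupLieAlgebra I G) {u : G × S → ℂ}
    (hu : MDifferentiable (I.prod J) 𝓘(ℝ, ℂ) u) (g : G) (h : S) :
    lieDeriv (I.prod J) (lieProdInl J S X) u (g, h) =
      lieDeriv I X (fun x => u (x, h)) g := by
  have hl : MDifferentiable I (I.prod J) (fun x : G => (x, h)) :=
    (contMDiff_id.prodMk contMDiff_const : ContMDiff I (I.prod J) ∞ fun x : G => (x, h)).mdifferentiable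
      (by simp)
  refine (lieDeriv_eq_mfderiv_comp_mul_left _ hu _).trans
    (Eq.trans ?_ (lieDeriv_eq_mfderiv_comp_mul_left X (hu.comp hl) g).symm)
  have hm : MDifferentiable (I.prod J) (I.prod J) (fun x : G × S => (g, h) * x) :=
    (contMDiff_mul_left (I := I.prod J) (n := ∞) (a := (g, h))).mdifferentiable (by simp)
  have hc := mfderiv_comp (I' := I.prod J) (1 : G) (g := fun p => u ((g, h) * p))
    (f := fun x : G => (x, (1 : S))) ((hu.comp hm).mdifferentiableAt)
    (mdifferentiableAt_id.prodMk mdifferentiableAt_const)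
  rw [mfderiv_prod_left] at hc
  have heq : (fun p => u ((g, h) * p)) ∘ (fun x : G => (x, (1 : S))) =
      fun x => (u ∘ fun x => (x, h)) (g * x) := by
    ext x
    simp
  rw [heq] at hc
  exact (congrArg (fun A => A X) hc).symm

theorem lieGroup_minSmoothness_three : LieGroup I (minSmoothness ℝ 3) G :=
  .of_le (n := ∞) (by
    simpa using (mod_cast le_top : ((3 : ℕ∞) : WithTop ℕ∞) ≤ ((⊤ : ℕ∞) : WithTop ℕ∞)))

theorem continuous_lieDeriv (Y : GroupLieAlgebra I G) {u : G → ℂ}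
    (hu : ContMDiff I 𝓘(ℝ, ℂ) ∞ u) : Continuous (lieDeriv I Y u) := by
  have : LieGroup I (minSmoothness ℝ 3) G := lieGroup_minSmoothness_three
  have h1 := contMDiff_mulInvariantVectorField (I := I) (G := G) Y
  have : IsManifold I 1 G := .of_le (n := ∞) (by simp)
  have h2 := hu.contMDiff_tangentMap (m := 0) (by simp)
  have h3 := contMDiff_snd_tangentBundle_modelSpace (n := 0) ℂ 𝓘(ℝ, ℂ)
  exact h3.continuous.comp (h2.continuous.comp h1.continuous)

/-- Differentiation under the integral sign along a left-invariant vector field. -/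
theorem lieDeriv_integral_mul [FiniteDimensional ℝ E] [I.Boundaryless] [T2Space G]
    [LocallyCompactSpace G]
    [FiniteDimensional ℝ E'] [J.Boundaryless] [T2Space S] [LocallyCompactSpace S]
    [SecondCountableTopology S]
    [MeasurableSpace S] [BorelSpace S] (X : GroupLieAlgebra I G)
    (ν : Measure S) {f : G × S → ℂ}
    (hf : ContMDiff (I.prod J) 𝓘(ℝ, ℂ) ∞ f) {θ : S → ℂ} (hθ : Integrable θ ν)
    (hc : HasCompactSupport θ) (g : G) :
    lieDeriv I X (fun g => ∫ s, θ s * f (g, s) ∂ν) g = ∫ s, θ s * lieDeriv (I.prod J)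
      (lieProdInl J S X) f (g, s) ∂ν := by
  have : LieGroup I (minSmoothness ℝ 3) G := lieGroup_minSmoothness_three
  have : IsManifold I 1 G := .of_le (n := ∞) (by simp)
  have hX := (contMDiff_mulInvariantVectorField (I := I) (G := G) X).of_le
    (m := 1) (by simp)
  obtain ⟨γ, hγ0, hγ⟩ := exists_isMIntegralCurveAt_of_contMDiffAt_boundaryless (I := I) 0
    (hX.contMDiffAt (x := g))
  set D := lieDeriv (I.prod J) (lieProdInl J S X) f with hD
  have hDc : Continuous D := continuous_lieDeriv _ hf
  have hfm : MDifferentiable (I.prod J) 𝓘(ℝ, ℂ) f := hf.mdifferentiable (by simp)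
  have hFm : MDifferentiable I 𝓘(ℝ, ℂ) (fun g => ∫ s, θ s * f (g, s) ∂ν) :=
    (contMDiff_integral_mul ν hf hθ hc).mdifferentiable (by simp)
  have hsl : ∀ s, MDifferentiable I 𝓘(ℝ, ℂ) (fun x => f (x, s)) := fun s =>
    hfm.comp ((contMDiff_id.prodMk contMDiff_const :
      ContMDiff I (I.prod J) ∞ fun x : G => (x, s)).mdifferentiable (by simp))
  obtain ⟨Q, hQc, hQ⟩ := exists_compact_mem_nhds g
  obtain ⟨C, hC⟩ := ((hQc.prod hc.isCompact).exists_bound_of_continuousOn hDc.continuousOn)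
  have hγc : ∀ᶠ t in 𝓝 (0 : ℝ), γ t ∈ Q :=
    (hγ.self_of_nhds.continuousAt) (by rwa [hγ0])
  have hev := hγ.eventually_hasDerivAt_comp
  -- Dominated differentiation along `γ`; the bound is uniform because `D` is continuous on the
  -- compact `Q ×ˢ tsupport θ`.
  have key := hasDerivAt_integral_of_dominated_loc_of_deriv_le (μ := ν) (x₀ := (0 : ℝ))
    (F := fun t s => θ s * f (γ t, s)) (F' := fun t s => θ s * D (γ t, s))
    (bound := fun s => ‖θ s‖ * C) (hγc.and hev) ?_ ?_ ?_ ?_ (hθ.norm.mul_const C) ?_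
  · have h1 := hev.self_of_nhds _ hFm
    rw [hγ0] at h1
    simpa [hγ0] using h1.unique key.2
  · exact .of_forall fun t => (hθ.mul_continuous_of_hasCompactSupport hc
      (hf.continuous.comp (by fun_prop : Continuous fun s => (γ t, s)))).aestronglyMeasurable
  · exact hθ.mul_continuous_of_hasCompactSupport hc
      (hf.continuous.comp (by fun_prop : Continuous fun s => (γ 0, s)))
  · exact (hθ.mul_continuous_of_hasCompactSupport hc
      (hDc.comp (by fun_prop : Continuous fun s => (γ 0, s)))).aestronglyMeasurable
  · refine .of_forall fun s t ht => ?_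
    rw [norm_mul]
    by_cases hs : s ∈ tsupport θ
    · exact mul_le_mul_of_nonneg_left (hC _ ⟨ht.1, hs⟩) (norm_nonneg _)
    · simp [image_eq_zero_of_notMem_tsupport hs]
  · refine .of_forall fun s t ht => ?_
    have := (ht.2 _ (hsl s)).const_mul (θ s)
    rwa [← lieDeriv_lieProdInl X hfm] at this

end LieDerivative

/-! ### Correlations as coefficients, and two-sided averages. -/

section Correlation

open scoped Topology Pointwise

/-- The function `g ↦ ∫ f(g⁻¹x) k(x) dx`. -/
noncomputable def correlation {N : Type*} [Group N] [MeasurableSpace N] (ν : Measure N)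
    (f k : N → ℂ) (g : N) : ℂ := ∫ x, f (g⁻¹ * x) * k x ∂ν

variable {N : Type*} [TopologicalSpace N] [Group N] [IsTopologicalGroup N]

theorem hasCompactSupport_correlation [MeasurableSpace N] (ν : Measure N) {f k : N → ℂ}
    (hfc : HasCompactSupport f) (hkc : HasCompactSupport k) :
    HasCompactSupport (correlation ν f k) := by
  refine HasCompactSupport.intro (hkc.isCompact.mul hfc.isCompact.inv) fun g hg => ?_
  refine integral_eq_zero_of_ae (.of_forall fun x => ?_)
  by_contra h
  obtain ⟨h1, h2⟩ := mul_ne_zero_iff.1 h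
  exact hg ⟨x, subset_tsupport _ h2, (g⁻¹ * x)⁻¹,
    Set.inv_mem_inv.2 (subset_tsupport _ h1), by group⟩

variable
    [T2Space N] [LocallyCompactSpace N] [SecondCountableTopology N] [MeasurableSpace N]
    [BorelSpace N] (ν : Measure N) [ν.IsHaarMeasure]

/-- Take `ξ = f` and `η` the complex conjugate of `k`, since the inner product conjugates `η`. -/
theorem exists_correlation_eq_coefficient {f k : N → ℂ} (hf : Continuous f)
    (hfc : HasCompactSupport f) (hk : Continuous k) (hkc : HasCompactSupport k) :
    ∃ ξ η : L2 ν, correlation ν f k = coefficient ξ η := by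
  have hf2 : MemLp f 2 ν := hf.memLp_of_hasCompactSupport hfc
  have hk2 : MemLp (fun x => star (k x)) 2 ν :=
    (continuous_star.comp hk).memLp_of_hasCompactSupport (hkc.comp_left (star_zero ℂ))
  refine ⟨hf2.toLp f, hk2.toLp _, ?_⟩
  ext g
  rw [coefficient, L2.inner_def]
  refine integral_congr_ae ?_
  filter_upwards [leftRegular_ae ν g (hf2.toLp f), hk2.coeFn_toLp,
    (measurePreserving_mul_left ν g⁻¹).quasiMeasurePreserving.ae hf2.coeFn_toLp] with x h1 h2 h3
  rw [h1, h2, h3]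
  simp [RCLike.inner_apply]

theorem continuous_correlation {f k : N → ℂ} (hf : Continuous f)
    (hfc : HasCompactSupport f) (hk : Continuous k) (hkc : HasCompactSupport k) :
    Continuous (correlation ν f k) := by
  obtain ⟨ξ, η, h⟩ := exists_correlation_eq_coefficient ν hf hfc hk hkc
  exact h ▸ continuous_coefficient ξ η

theorem correlation_sub {f k k' : N → ℂ} (hf : Continuous f)
    (hk : Continuous k) (hkc : HasCompactSupport k)
    (hk' : Continuous k') (hkc' : HasCompactSupport k') (g : N) :
    correlation ν f (fun x => k x - k' x) g = correlation ν f k g - correlation ν f k' g := by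
  have hfg : Continuous fun x => f (g⁻¹ * x) := hf.comp (continuous_const_mul _)
  rw [correlation, correlation, correlation, ← integral_sub]
  · simp_rw [mul_sub]
  · exact (hfg.mul hk).integrable_of_hasCompactSupport hkc.mul_left
  · exact (hfg.mul hk').integrable_of_hasCompactSupport hkc'.mul_left

theorem correlation_prod (f₁ f₂ k₁ k₂ : N → ℂ) (g h : N) :
    correlation (ν.prod ν) (fun p => f₁ p.1 * f₂ p.2) (fun p => k₁ p.1 * k₂ p.2) (g, h) =
      correlation ν f₁ k₁ g * correlation ν f₂ k₂ h := by
  rw [correlation, correlation, correlation, ← integral_prod_mul]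
  refine integral_congr_ae (.of_forall fun p => ?_)
  simp only [Prod.inv_mk, Prod.fst_mul, Prod.snd_mul]
  ring

theorem HasCompactSupport.mul_prod {N : Type*} [TopologicalSpace N] {f k : N → ℂ}
    (hf : HasCompactSupport f) (hk : HasCompactSupport k) :
    HasCompactSupport fun p : N × N => f p.1 * k p.2 := by
  refine HasCompactSupport.intro' (hf.isCompact.prod hk.isCompact)
    ((isClosed_tsupport f).prod (isClosed_tsupport k)) fun p hp => ?_
  by_contra h
  obtain ⟨h1, h2⟩ := mul_ne_zero_iff.1 h
  exact hp ⟨subset_tsupport _ h1, subset_tsupport _ h2⟩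

/-- The average of the two-sided translates of `P` with weight `φ ⊗ φ`. -/
noncomputable def smear (φ : N → ℝ) (P : N → ℂ) (g : N) : ℂ :=
  ∫ s : N × N, ((φ s.1 * φ s.2 : ℝ) : ℂ) * P (s.2⁻¹ * g * s.1) ∂(ν.prod ν)

theorem integrable_smear {φ : N → ℝ} (hφ : Continuous φ) (hφc : HasCompactSupport φ) {P : N → ℂ}
    (hP : Continuous P) (g : N) :
    Integrable (fun s : N × N => ((φ s.1 * φ s.2 : ℝ) : ℂ) * P (s.2⁻¹ * g * s.1)) (ν.prod ν) := by
  have h1 : HasCompactSupport fun x => (φ x : ℂ) := hφc.comp_left Complex.ofReal_zero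
  have h2 := h1.mul_prod h1
  simp_rw [← Complex.ofReal_mul] at h2
  refine Continuous.integrable_of_hasCompactSupport ?_ h2.mul_right
  have : Continuous fun s : N × N => P (s.2⁻¹ * g * s.1) := hP.comp (by fun_prop)
  fun_prop

/-- Averaging on both sides makes the smeared function and its reflection `h ↦ smear ν φ P h⁻¹` both
correlations with first entry `φ`, using left translations of the measure only, so no modular
function appears. -/
theorem smear_eq_correlation {φ : N → ℝ} (hφ : Continuous φ) (hφc : HasCompactSupport φ)
    {P : N → ℂ} (hP : Continuous P) (g : N) :
    smear ν φ P g = correlation ν (fun x => φ x)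
      (correlation ν (fun z => P z⁻¹) fun x => φ x) g := by
  rw [smear, integral_prod _ (integrable_smear ν hφ hφc hP g), correlation,
    ← integral_mul_left_eq_self (fun x => (φ (g⁻¹ * x) : ℂ) * _) g]
  refine integral_congr_ae (.of_forall fun x => ?_)
  simp only [correlation, inv_mul_cancel_left, ← integral_const_mul, mul_inv_rev, inv_inv,
    Complex.ofReal_mul]
  refine integral_congr_ae (.of_forall fun y => ?_)
  simp only [mul_assoc]
  ring

theorem smear_inv_eq_correlation {φ : N → ℝ} (hφ : Continuous φ) (hφc : HasCompactSupport φ)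
    {P : N → ℂ} (hP : Continuous P) (h : N) :
    smear ν φ P h⁻¹ = correlation ν (fun x => φ x) (correlation ν P fun x => φ x) h := by
  rw [smear, integral_prod_symm _ (integrable_smear ν hφ hφc hP h⁻¹), correlation,
    ← integral_mul_left_eq_self (fun x => (φ (h⁻¹ * x) : ℂ) * _) h]
  refine integral_congr_ae (.of_forall fun y => ?_)
  simp only [correlation, inv_mul_cancel_left, ← integral_const_mul, mul_inv_rev,
    Complex.ofReal_mul]
  refine integral_congr_ae (.of_forall fun x => ?_)
  simp only [mul_assoc]
  ring

end Correlation

/-! ### Elements of `A_c(G × G)` vanishing on the anti-diagonal. -/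

section AntisymmetricSmear

/-- The function `(g, h) ↦ p(g) q(h⁻¹) - q(g) p(h⁻¹)`, which vanishes on the anti-diagonal. -/
def wedge {G : Type*} [Group G] (p q : G → ℂ) (x : G × G) : ℂ :=
  p x.1 * q x.2⁻¹ - q x.1 * p x.2⁻¹

theorem wedge_antidiagonal {G : Type*} [Group G] (p q : G → ℂ) {x : G × G}
    (hx : x ∈ antidiagonalSet G) : wedge p q x = 0 := by
  obtain ⟨g, rfl⟩ := hx
  simp [wedge, mul_comm]

variable {N : Type*} [TopologicalSpace N] [Group N] [IsTopologicalGroup N] [T2Space N]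
  [LocallyCompactSpace N] [SecondCountableTopology N] [MeasurableSpace N]
  [BorelSpace N] (ν : Measure N) [ν.IsHaarMeasure]

/-- The antisymmetrized smeared functions are matrix coefficients with compact support. -/
theorem wedge_smear_mem_fourierAc {φ : N → ℝ} (hφ : Continuous φ) (hφc : HasCompactSupport φ)
    {P Q : N → ℂ} (hP : Continuous P) (hPc : HasCompactSupport P)
    (hQ : Continuous Q) (hQc : HasCompactSupport Q) :
    wedge (smear ν φ P) (smear ν φ Q) ∈ fourierAc (ν.prod ν) := by
  set f : N → ℂ := fun x => φ x with hf
  have hfcont : Continuous f := Complex.continuous_ofReal.comp hφ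
  have hfc : HasCompactSupport f := hφc.comp_left Complex.ofReal_zero
  have aux : ∀ {R : N → ℂ}, Continuous R → HasCompactSupport R →
      Continuous (correlation ν R f) ∧ HasCompactSupport (correlation ν R f) := fun hR hRc =>
    ⟨continuous_correlation ν hR hRc hfcont hfc, hasCompactSupport_correlation ν hRc hfc⟩
  have inv : ∀ {R : N → ℂ}, Continuous R → HasCompactSupport R →
      Continuous (fun z => R z⁻¹) ∧ HasCompactSupport (fun z => R z⁻¹) := fun hR hRc =>
    ⟨hR.comp continuous_inv, hRc.comp_homeomorph (Homeomorph.inv N)⟩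
  obtain ⟨hBP, hBPc⟩ := aux (inv hP hPc).1 (inv hP hPc).2
  obtain ⟨hBQ, hBQc⟩ := aux (inv hQ hQc).1 (inv hQ hQc).2
  obtain ⟨hAP, hAPc⟩ := aux hP hPc
  obtain ⟨hAQ, hAQc⟩ := aux hQ hQc
  have cprod : ∀ {a b : N → ℂ}, Continuous a → Continuous b →
      Continuous fun p : N × N => a p.1 * b p.2 := fun ha hb =>
    (ha.comp continuous_fst).mul (hb.comp continuous_snd)
  -- Both terms share the first entry `φ ⊗ φ`, so their difference is a single correlation, hence a
  -- single coefficient.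
  have hw : wedge (smear ν φ P) (smear ν φ Q) = correlation (ν.prod ν) (fun p => f p.1 * f p.2)
      (fun p => correlation ν (fun z => P z⁻¹) f p.1 * correlation ν Q f p.2 -
        correlation ν (fun z => Q z⁻¹) f p.1 * correlation ν P f p.2) := by
    ext ⟨g, h⟩
    rw [correlation_sub _ (cprod hfcont hfcont) (cprod hBP hAQ) (hBPc.mul_prod hAQc)
      (cprod hBQ hAP) (hBQc.mul_prod hAPc), correlation_prod, correlation_prod, wedge]
    simp only
    rw [smear_eq_correlation ν hφ hφc hP g, smear_eq_correlation ν hφ hφc hQ g,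
      smear_inv_eq_correlation ν hφ hφc hP, smear_inv_eq_correlation ν hφ hφc hQ]
  have hk := ((cprod hBP hAQ).sub (cprod hBQ hAP))
  have hkc := ((hBPc.mul_prod hAQc).sub (hBQc.mul_prod hAPc))
  rw [hw]
  exact ⟨exists_correlation_eq_coefficient _ (cprod hfcont hfcont) (hfc.mul_prod hfc) hk hkc,
    hasCompactSupport_correlation _ (hfc.mul_prod hfc) hkc⟩

end AntisymmetricSmear

/-! ### Product rules, and convergence of averages together with derivatives. -/

section LieDerivRules

open scoped Topology Pointwise

/-- A continuous family of functions with supports in a common compact set is uniformly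
continuous in the parameter. -/
theorem eventually_norm_sub_le_of_isCompact {A T : Type*} [TopologicalSpace A] [TopologicalSpace T]
    {D : A × T → ℂ} (hD : Continuous D) {C : Set A} (hC : IsCompact C) {t₀ : T}
    (h0 : ∀ᶠ t in 𝓝 t₀, ∀ a ∉ C, D (a, t) = 0) {ε : ℝ} (hε : 0 < ε) :
    ∀ᶠ t in 𝓝 t₀, ∀ a, ‖D (a, t) - D (a, t₀)‖ ≤ ε := by
  have h1 : ∀ᶠ t in 𝓝 t₀, ∀ a ∈ C, ‖D (a, t) - D (a, t₀)‖ < ε := by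
    refine hC.eventually_forall_of_forall_eventually fun a _ => ?_
    refine IsOpen.mem_nhds (isOpen_lt (f := fun z : T × A => ‖D (z.2, z.1) - D (z.2, t₀)‖)
      (by fun_prop) continuous_const) ?_
    simpa using hε
  filter_upwards [h0, h1] with t ht1 ht2 a
  by_cases ha : a ∈ C
  · exact (ht2 a ha).le
  · simp [ht1 a ha, h0.self_of_nhds a ha, hε.le]

theorem continuous_hasCompactSupport_ofReal_mul_prod {G : Type*} [TopologicalSpace G]
    {φ : G → ℝ} (hφ : Continuous φ) (hφc : HasCompactSupport φ) :
    Continuous (fun s : G × G => ((φ s.1 * φ s.2 : ℝ) : ℂ)) ∧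
      HasCompactSupport (fun s : G × G => ((φ s.1 * φ s.2 : ℝ) : ℂ)) := by
  have h1 : HasCompactSupport fun x => (φ x : ℂ) := hφc.comp_left Complex.ofReal_zero
  have h2 := h1.mul_prod h1
  simp_rw [← Complex.ofReal_mul] at h2
  exact ⟨by fun_prop, h2⟩

variable {E H G : Type*} [NormedAddCommGroup E] [NormedSpace ℝ E]
  [TopologicalSpace H] {I : ModelWithCorners ℝ E H}
  [TopologicalSpace G] [Group G] [ChartedSpace H G]

theorem lieDeriv_eq_zero_of_notMem_tsupport (X : GroupLieAlgebra I G) {u : G → ℂ} {g : G}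
    (hg : g ∉ tsupport u) : lieDeriv I X u g = 0 := by
  have h : u =ᶠ[𝓝 g] fun _ => 0 := notMem_tsupport_iff_eventuallyEq.1 hg
  rw [lieDeriv, h.mfderiv_eq, mfderiv_const]
  rfl

theorem contMDiff_translates [LieGroup I ∞ G] {P : G → ℂ} (hP : ContMDiff I 𝓘(ℝ, ℂ) ∞ P) :
    ContMDiff (I.prod (I.prod I)) 𝓘(ℝ, ℂ) ∞
      (fun z : G × (G × G) => P (z.2.2⁻¹ * z.1 * z.2.1)) :=
  hP.comp (((contMDiff_snd.comp contMDiff_snd).inv.mul contMDiff_fst).mul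
    (contMDiff_fst.comp contMDiff_snd))

variable [LieGroup I ∞ G] [I.Boundaryless] [FiniteDimensional ℝ E]

theorem exists_curve_hasDerivAt_lieDeriv (X : GroupLieAlgebra I G) (g : G) :
    ∃ γ : ℝ → G, γ 0 = g ∧ ∀ u : G → ℂ, MDifferentiable I 𝓘(ℝ, ℂ) u →
      HasDerivAt (fun τ => u (γ τ)) (lieDeriv I X u g) 0 := by
  have : LieGroup I (minSmoothness ℝ 3) G := lieGroup_minSmoothness_three
  have : IsManifold I 1 G := .of_le (n := ∞) (by simp)
  have hX := (contMDiff_mulInvariantVectorField (I := I) (G := G) X).of_le (m := 1) (by simp)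
  obtain ⟨γ, hγ0, hγ⟩ := exists_isMIntegralCurveAt_of_contMDiffAt_boundaryless (I := I) 0
    (hX.contMDiffAt (x := g))
  refine ⟨γ, hγ0, fun u hu => ?_⟩
  have := hγ.eventually_hasDerivAt_comp.self_of_nhds u hu
  rwa [hγ0] at this

theorem lieDeriv_mul (X : GroupLieAlgebra I G) {p q : G → ℂ} (hp : MDifferentiable I 𝓘(ℝ, ℂ) p)
    (hq : MDifferentiable I 𝓘(ℝ, ℂ) q) (g : G) :
    lieDeriv I X (fun x => p x * q x) g = lieDeriv I X p g * q g + p g * lieDeriv I X q g := by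
  obtain ⟨γ, hγ0, h⟩ := exists_curve_hasDerivAt_lieDeriv X g
  have h1 := (h p hp).mul (h q hq)
  have h2 : HasDerivAt (fun τ => p (γ τ) * q (γ τ)) (lieDeriv I X (fun x => p x * q x) g) 0 :=
    h _ (hp.mul hq)
  simpa [hγ0] using h2.unique h1

theorem lieDeriv_mul_const_sub_mul_const (X : GroupLieAlgebra I G) {p q : G → ℂ}
    (hp : MDifferentiable I 𝓘(ℝ, ℂ) p) (hq : MDifferentiable I 𝓘(ℝ, ℂ) q) (a b : ℂ) (g : G) :
    lieDeriv I X (fun x => p x * a - q x * b) g = lieDeriv I X p g * a - lieDeriv I X q g * b := by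
  obtain ⟨γ, hγ0, h⟩ := exists_curve_hasDerivAt_lieDeriv X g
  exact (h _ ((hp.mul mdifferentiable_const).sub (hq.mul mdifferentiable_const))).unique
    (((h p hp).mul_const a).sub ((h q hq).mul_const b))

variable [T2Space G] [IsTopologicalGroup G] [LocallyCompactSpace G] [SecondCountableTopology G]
  [MeasurableSpace G] [BorelSpace G] (μ : Measure G) [μ.IsHaarMeasure]

theorem contMDiff_smear {φ : G → ℝ} (hφ : Continuous φ) (hφc : HasCompactSupport φ) {P : G → ℂ}
    (hP : ContMDiff I 𝓘(ℝ, ℂ) ∞ P) : ContMDiff I 𝓘(ℝ, ℂ) ∞ (smear μ φ P) :=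
  have h := continuous_hasCompactSupport_ofReal_mul_prod hφ hφc
  contMDiff_integral_mul (μ.prod μ) (contMDiff_translates hP)
    (h.1.integrable_of_hasCompactSupport h.2) h.2

/-- Smearing with a bump concentrated at `1` approximates a test function and its derivative. -/
theorem exists_nhds_norm_smear_sub_le (X : GroupLieAlgebra I G) {P : G → ℂ}
    (hP : IsTestFunction I P) {ε : ℝ} (hε : 0 < ε) :
    ∃ V ∈ 𝓝 (1 : G), ∀ φ : G → ℝ, Continuous φ → HasCompactSupport φ → tsupport φ ⊆ V →
      (∀ x, 0 ≤ φ x) → ∫ x, φ x ∂μ = 1 → ∀ g, ‖smear μ φ P g - P g‖ ≤ ε ∧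
        ‖lieDeriv I X (smear μ φ P) g - lieDeriv I X P g‖ ≤ ε := by
  have hf := contMDiff_translates hP.1
  set f : G × (G × G) → ℂ := fun z => P (z.2.2⁻¹ * z.1 * z.2.1) with hfdef
  set D := lieDeriv (I.prod (I.prod I)) (lieProdInl (I.prod I) (G × G) X) f with hD
  have hDc : Continuous D := continuous_lieDeriv _ hf
  have hDs : ∀ g s, D (g, s) = lieDeriv I X (fun x => f (x, s)) g := fun g s =>
    lieDeriv_lieProdInl X (hf.mdifferentiable (by simp)) g s
  obtain ⟨Q, hQc, hQ⟩ := exists_compact_mem_nhds (1 : G)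
  -- One compact set containing the supports of all translates of `P` by `s ∈ Q × Q`; it gives
  -- estimates uniform in `g`.
  set C := Q * tsupport P * Q⁻¹ with hC
  have hCc : IsCompact C := (hQc.mul hP.2.isCompact).mul hQc.inv
  have hs : ∀ᶠ s in 𝓝 (1 : G × G), s.1 ∈ Q ∧ s.2 ∈ Q := prod_mem_nhds hQ hQ
  have hsf : ∀ s : G × G, s.1 ∈ Q ∧ s.2 ∈ Q → ∀ g ∉ C, f (g, s) = 0 := by
    intro s hs g hg
    refine image_eq_zero_of_notMem_tsupport (f := P) fun h => hg ?_
    exact ⟨s.2 * (s.2⁻¹ * g * s.1), ⟨_, hs.2, _, h, rfl⟩, s.1⁻¹, Set.inv_mem_inv.2 hs.1, by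
      simp [mul_assoc]⟩
  have e1 := eventually_norm_sub_le_of_isCompact hf.continuous hCc (hs.mono hsf) hε
  have e2 := eventually_norm_sub_le_of_isCompact hDc hCc (t₀ := 1) (hs.mono fun s hs g hg => by
    rw [hDs]
    refine lieDeriv_eq_zero_of_notMem_tsupport X fun h => hg ?_
    refine closure_minimal (fun x hx => ?_) hCc.isClosed h
    by_contra hx'
    exact hx (hsf s hs x hx')) hε
  obtain ⟨V₁, hV₁, V₂, hV₂, hV⟩ := mem_nhds_prod_iff.1 (e1.and e2)
  refine ⟨V₁ ∩ V₂, Filter.inter_mem hV₁ hV₂, fun φ hφ hφc hφV hφ0 hφ1 g => ?_⟩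
  have hθ := continuous_hasCompactSupport_ofReal_mul_prod hφ hφc
  have hθi := hθ.1.integrable_of_hasCompactSupport hθ.2 (μ := μ.prod μ)
  have h1 : ∫ s : G × G, φ s.1 * φ s.2 ∂(μ.prod μ) = 1 := by
    rw [integral_prod_mul, hφ1, one_mul]
  have h0 : ∀ s : G × G, 0 ≤ φ s.1 * φ s.2 := fun s => mul_nonneg (hφ0 _) (hφ0 _)
  have hsupp : ∀ s ∈ Function.support (fun s : G × G => φ s.1 * φ s.2),
      (∀ a, ‖f (a, s) - f (a, 1)‖ ≤ ε) ∧ ∀ a, ‖D (a, s) - D (a, 1)‖ ≤ ε := by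
    intro s hs
    obtain ⟨ha, hb⟩ := mul_ne_zero_iff.1 hs
    exact hV ⟨(hφV (subset_tsupport _ ha)).1, (hφV (subset_tsupport _ hb)).2⟩
  have hf1 : ∀ x, f (x, 1) = P x := fun x => by simp [hfdef]
  have hslice : Continuous fun s : G × G => (g, s) := by fun_prop
  constructor
  · have := norm_integral_smul_sub_le h0 h1 (f := fun s => f (g, s)) (by
      simp_rw [Complex.real_smul]
      exact hθi.mul_continuous_of_hasCompactSupport hθ.2 (hf.continuous.comp hslice)) (f (g, 1))
      fun s hs => (hsupp s hs).1 g
    simp_rw [Complex.real_smul] at this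
    rwa [hf1] at this
  · have := norm_integral_smul_sub_le h0 h1 (f := fun s => D (g, s)) (by
      simp_rw [Complex.real_smul]
      exact hθi.mul_continuous_of_hasCompactSupport hθ.2 (hDc.comp hslice)) (D (g, 1))
      fun s hs => (hsupp s hs).2 g
    simp_rw [Complex.real_smul] at this
    -- The average of `D` is the derivative of the average.
    rw [← lieDeriv_integral_mul X (μ.prod μ) hf hθi hθ.2 g, hDs g 1] at this
    simp_rw [hf1] at this
    exact this

end LieDerivRules

/-! ### Consequences of local synthesis for functionals in `VN`. -/

section LocalSynthesis

variable {N : Type*} [Group N] [MeasurableSpace N] [MeasurableMul N]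
  {ν : Measure N} [ν.IsMulLeftInvariant]

theorem fourierNorm_zero : fourierNorm ν (0 : N → ℂ) = 0 := by
  refine le_antisymm ?_ bot_le
  have h : (0 : N → ℂ) = coefficient (0 : L2 ν) 0 := by
    ext g
    simp [coefficient]
  exact (iInf₂_le_of_le 0 0 (iInf_le_of_le h le_rfl)).trans_eq (by simp)

/-- For a set of local synthesis, a functional in `VN` that kills `I⁰(C)` kills `I(C) ∩ A_c`. -/
theorem inner_eq_zero_of_isLocalSynthesisSet [TopologicalSpace N] {C : Set N} (hC : IsLocalSynthesisSet ν C)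
    {S : L2 ν →L[ℂ] L2 ν} (hS : S ∈ groupVN ν)
    (h0 : ∀ ξ η : L2 ν, coefficient ξ η ∈ smallIdeal ν C → inner ℂ η (S ξ) = 0)
    {ξ η : L2 ν} (hu : coefficient ξ η ∈ fourierAc ν) (huC : ∀ g ∈ C, coefficient ξ η g = 0) :
    inner ℂ η (S ξ) = 0 := by
  have hloc : coefficient ξ η ∈ localIdeal ν C :=
    ⟨hu.1, fun ε hε => ⟨_, ⟨⟨hu.1, huC⟩, hu⟩, by rwa [sub_self, fourierNorm_zero]⟩⟩
  rw [← show fourierClosure ν (smallIdeal ν C) = localIdeal ν C from hC] at hloc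
  refine norm_le_zero_iff.1 (nonpos_of_forall_pos_le_mul (b := ‖S‖) fun ε hε => ?_)
  obtain ⟨w, hw, hlt⟩ := hloc.2 (ENNReal.ofReal ε) (ENNReal.ofReal_pos.2 hε)
  obtain ⟨ξ₁, η₁, rfl⟩ := hw.1.1
  simp only [fourierNorm, iInf_lt_iff] at hlt
  obtain ⟨ξ₂, η₂, h, hlt⟩ := hlt
  rw [← ofReal_norm, ← ofReal_norm, ← ENNReal.ofReal_mul (norm_nonneg _),
    ENNReal.ofReal_lt_ofReal_iff hε] at hlt
  -- The relation is `u - w - (u - w) = 0`, with `ξ₂, η₂` a nearly optimal representation of `u -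
  -- w`. As `S` kills `w`, its value at `u` is at most `ε‖S‖` in norm.
  have hsum := sum_inner_eq_zero_of_sum_coefficient_eq_zero hS ![ξ, ξ₁, ξ₂] ![η, -η₁, -η₂] (by
    ext g
    have := congrFun h g
    simp only [Pi.sub_apply] at this
    simp only [Fin.sum_univ_three, Pi.add_apply, Matrix.cons_val, coefficient, inner_neg_left,
      Pi.zero_apply] at this ⊢
    linear_combination this)
  simp only [Fin.sum_univ_three, Matrix.cons_val, inner_neg_left, h0 _ _ hw] at hsum
  have heq : inner ℂ η (S ξ) = inner ℂ η₂ (S ξ₂) := by linear_combination hsum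
  calc ‖inner ℂ η (S ξ)‖ ≤ ‖η₂‖ * ‖S ξ₂‖ := heq ▸ norm_inner_le_norm _ _
    _ ≤ ‖η₂‖ * (‖S‖ * ‖ξ₂‖) := mul_le_mul_of_nonneg_left (S.le_opNorm _) (norm_nonneg _)
    _ = (‖ξ₂‖ * ‖η₂‖) * ‖S‖ := by ring
    _ ≤ ε * ‖S‖ := mul_le_mul_of_nonneg_right hlt.le (norm_nonneg _)

end LocalSynthesis

/-! ### Wronskians and the vanishing of `v`. -/

section Wronskian

open scoped Topology

variable {E H G : Type*} [NormedAddCommGroup E] [NormedSpace ℝ E]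
  [TopologicalSpace H] {I : ModelWithCorners ℝ E H}
  [TopologicalSpace G] [Group G] [ChartedSpace H G]

theorem contMDiff_mul_complex {M : Type*} [TopologicalSpace M] [ChartedSpace H M] {P Q : M → ℂ}
    (hP : ContMDiff I 𝓘(ℝ, ℂ) ∞ P) (hQ : ContMDiff I 𝓘(ℝ, ℂ) ∞ Q) :
    ContMDiff I 𝓘(ℝ, ℂ) ∞ fun x => P x * Q x :=
  (contDiff_mul (𝕜 := ℝ) (𝔸 := ℂ)).comp_contMDiff (hP.prodMk_space hQ)

theorem IsTestFunction.mul {M : Type*} [TopologicalSpace M] [ChartedSpace H M] {P Q : M → ℂ}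
    (hP : IsTestFunction I P) (hQ : IsTestFunction I Q) :
    IsTestFunction I fun x => P x * Q x :=
  ⟨contMDiff_mul_complex hP.1 hQ.1, hP.2.mul_right⟩

theorem IsTestFunction.ofReal {M : Type*} [TopologicalSpace M] [ChartedSpace H M] {P : M → ℝ}
    (hP : ContMDiff I 𝓘(ℝ, ℝ) ∞ P) (hPc : HasCompactSupport P) : IsTestFunction I fun g => (P g : ℂ) :=
  ⟨Complex.ofRealCLM.contDiff.comp_contMDiff hP, hPc.comp_left Complex.ofReal_zero⟩

/-- The Wronskian `(∂_X p) q - (∂_X q) p`. -/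
noncomputable def wronskian (X : GroupLieAlgebra I G) (p q : G → ℂ) (g : G) : ℂ :=
  lieDeriv I X p g * q g - lieDeriv I X q g * p g

theorem lieDeriv_lieInl_wedge [LieGroup I ∞ G] [I.Boundaryless] [FiniteDimensional ℝ E]
    (X : GroupLieAlgebra I G) {p q : G → ℂ}
    (hp : ContMDiff I 𝓘(ℝ, ℂ) ∞ p) (hq : ContMDiff I 𝓘(ℝ, ℂ) ∞ q) :
    ContMDiff (I.prod I) 𝓘(ℝ, ℂ) ∞ (wedge p q) ∧
      ∀ g, lieDeriv (I.prod I) (lieInl I X) (wedge p q) (g, g⁻¹) = wronskian X p q g := by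
  have hw : ContMDiff (I.prod I) 𝓘(ℝ, ℂ) ∞ (wedge p q) :=
    (contMDiff_mul_complex (hp.comp contMDiff_fst) (hq.comp contMDiff_snd.inv)).sub
      (contMDiff_mul_complex (hq.comp contMDiff_fst) (hp.comp contMDiff_snd.inv))
  refine ⟨hw, fun g => ?_⟩
  have h1 := lieDeriv_lieProdInl X (hw.mdifferentiable (by simp)) g g⁻¹
  have h2 := lieDeriv_mul_const_sub_mul_const X (hp.mdifferentiable (by simp))
    (hq.mdifferentiable (by simp)) (q g⁻¹⁻¹) (p g⁻¹⁻¹) g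
  refine h1.trans (h2.trans ?_)
  rw [inv_inv, wronskian]

theorem IsTestFunction.exists_bound [LieGroup I ∞ G] {P : G → ℂ} (hP : IsTestFunction I P)
    (X : GroupLieAlgebra I G) : ∃ M, ∀ g, ‖P g‖ ≤ M ∧ ‖lieDeriv I X P g‖ ≤ M := by
  obtain ⟨M, hM⟩ := hP.1.continuous.bounded_above_of_compact_support hP.2
  have hc : HasCompactSupport (lieDeriv I X P) :=
    hP.2.mono' fun g hg => by
      by_contra h
      exact hg (lieDeriv_eq_zero_of_notMem_tsupport X h)
  obtain ⟨M', hM'⟩ := (continuous_lieDeriv X hP.1).bounded_above_of_compact_support hc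
  exact ⟨max M M', fun g => ⟨(hM g).trans (le_max_left _ _), (hM' g).trans (le_max_right _ _)⟩⟩

theorem norm_mul_sub_mul_le {a b a' b' : ℂ} {M ε : ℝ} (hε : ε ≤ 1) (ha : ‖a‖ ≤ M)
    (hb : ‖b‖ ≤ M) (ha' : ‖a' - a‖ ≤ ε) (hb' : ‖b' - b‖ ≤ ε) :
    ‖a' * b' - a * b‖ ≤ ε * (2 * M + 1) := by
  have h0 : 0 ≤ M := (norm_nonneg _).trans ha
  have h1 : ‖b'‖ ≤ M + 1 := by
    have := norm_add_le (b' - b) b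
    rw [sub_add_cancel] at this
    linarith
  calc ‖a' * b' - a * b‖ = ‖(a' - a) * b' + a * (b' - b)‖ := by ring_nf
    _ ≤ ‖a' - a‖ * ‖b'‖ + ‖a‖ * ‖b' - b‖ := by
      rw [← norm_mul, ← norm_mul]
      exact norm_add_le _ _
    _ ≤ ε * (M + 1) + M * ε := by gcongr; exact (norm_nonneg _).trans ha'
    _ = ε * (2 * M + 1) := by ring

theorem continuous_wronskian [LieGroup I ∞ G] (X : GroupLieAlgebra I G) {p q : G → ℂ}
    (hp : ContMDiff I 𝓘(ℝ, ℂ) ∞ p) (hq : ContMDiff I 𝓘(ℝ, ℂ) ∞ q) :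
    Continuous (wronskian X p q) :=
  ((continuous_lieDeriv X hp).mul hq.continuous).sub ((continuous_lieDeriv X hq).mul hp.continuous)

theorem integrable_wronskian_mul [LieGroup I ∞ G] [SecondCountableTopology G] [MeasurableSpace G]
    [BorelSpace G] {μ : Measure G} (X : GroupLieAlgebra I G) {v : G → ℂ} (hv : Integrable v μ)
    {P Q : G → ℂ} (hP : IsTestFunction I P) (hQ : IsTestFunction I Q) :
    Integrable (fun g => wronskian X P Q g * v g) μ := by
  obtain ⟨M, hM⟩ := hP.exists_bound X
  obtain ⟨M', hM'⟩ := hQ.exists_bound X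
  refine hv.bdd_mul (c := M * M' + M' * M) (continuous_wronskian X hP.1 hQ.1).aestronglyMeasurable
    (.of_forall fun g => (norm_sub_le _ _).trans ?_)
  have h0 : 0 ≤ M := (norm_nonneg _).trans (hM g).1
  have h0' : 0 ≤ M' := (norm_nonneg _).trans (hM' g).1
  rw [norm_mul, norm_mul]
  exact add_le_add (mul_le_mul (hM g).2 (hM' g).1 (norm_nonneg _) h0)
    (mul_le_mul (hM' g).2 (hM g).1 (norm_nonneg _) h0')

variable [LieGroup I ∞ G] [I.Boundaryless] [FiniteDimensional ℝ E] [T2Space G]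
  [IsTopologicalGroup G] [LocallyCompactSpace G] [SecondCountableTopology G]
  [MeasurableSpace G] [BorelSpace G] {μ : Measure G} [μ.IsHaarMeasure]

/-- Smearing by narrow bumps approximates `P`, `Q` and their `X`-derivatives uniformly, so the
Wronskians converge uniformly, which suffices against `v ∈ L¹`. -/
theorem integral_wronskian_mul_eq_zero (X : GroupLieAlgebra I G) {v : G → ℂ} (hv : Integrable v μ)
    {P Q : G → ℂ} (hP : IsTestFunction I P) (hQ : IsTestFunction I Q)
    (h : ∀ φ : G → ℝ, Continuous φ → HasCompactSupport φ →
      ∫ g, wronskian X (smear μ φ P) (smear μ φ Q) g * v g ∂μ = 0) :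
    ∫ g, wronskian X P Q g * v g ∂μ = 0 := by
  obtain ⟨M₁, hM₁⟩ := hP.exists_bound X
  obtain ⟨M₂, hM₂⟩ := hQ.exists_bound X
  set M := max M₁ M₂ with hM
  have hPM : ∀ g, ‖P g‖ ≤ M ∧ ‖lieDeriv I X P g‖ ≤ M := fun g =>
    ⟨(hM₁ g).1.trans (le_max_left _ _), (hM₁ g).2.trans (le_max_left _ _)⟩
  have hQM : ∀ g, ‖Q g‖ ≤ M ∧ ‖lieDeriv I X Q g‖ ≤ M := fun g =>
    ⟨(hM₂ g).1.trans (le_max_right _ _), (hM₂ g).2.trans (le_max_right _ _)⟩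
  have hWint := integrable_wronskian_mul X hv hP hQ
  have main : ∀ ε : ℝ, 0 < ε → ε ≤ 1 → ‖∫ g, wronskian X P Q g * v g ∂μ‖ ≤
      ε * ((2 * (2 * M + 1)) * ∫ g, ‖v g‖ ∂μ) := by
    intro ε hε hε1
    obtain ⟨V, hV, hVP⟩ := exists_nhds_norm_smear_sub_le μ X hP hε
    obtain ⟨V', hV', hVQ⟩ := exists_nhds_norm_smear_sub_le μ X hQ hε
    obtain ⟨φ, hφ, hφc, hφV, hφ0, hφ1⟩ :=
      exists_contMDiff_bump_integral_eq_one I μ (Filter.inter_mem hV hV')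
    have hp := hVP φ hφ.continuous hφc (fun s hs => (hφV hs).1) hφ0 hφ1
    have hq := hVQ φ hφ.continuous hφc (fun s hs => (hφV hs).2) hφ0 hφ1
    have hb : ∀ g, ‖wronskian X (smear μ φ P) (smear μ φ Q) g - wronskian X P Q g‖ ≤
        2 * (ε * (2 * M + 1)) := by
      intro g
      have e1 := norm_mul_sub_mul_le hε1 (hPM g).2 (hQM g).1 (hp g).2 (hq g).1
      have e2 := norm_mul_sub_mul_le hε1 (hQM g).2 (hPM g).1 (hq g).2 (hp g).1
      rw [wronskian, wronskian, sub_sub_sub_comm]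
      linarith [norm_sub_le_of_le e1 e2]
    have hc := continuous_wronskian X (contMDiff_smear μ hφ.continuous hφc hP.1)
      (contMDiff_smear μ hφ.continuous hφc hQ.1)
    have hdint : Integrable (fun g => (wronskian X (smear μ φ P) (smear μ φ Q) g -
        wronskian X P Q g) * v g) μ :=
      hv.bdd_mul (hc.sub (continuous_wronskian X hP.1 hQ.1)).aestronglyMeasurable (.of_forall hb)
    have e : ∫ g, wronskian X P Q g * v g ∂μ =
        -∫ g, (wronskian X (smear μ φ P) (smear μ φ Q) g - wronskian X P Q g) * v g ∂μ := by
      have hadd := integral_add hdint hWint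
      simp_rw [sub_mul, sub_add_cancel, h φ hφ.continuous hφc] at hadd
      simp_rw [sub_mul]
      linear_combination -hadd
    rw [e, norm_neg]
    calc _ ≤ ∫ g, 2 * (ε * (2 * M + 1)) * ‖v g‖ ∂μ :=
          norm_integral_le_of_norm_le (hv.norm.const_mul _) (.of_forall fun g => by
            rw [norm_mul]
            exact mul_le_mul_of_nonneg_right (hb g) (norm_nonneg _))
      _ = _ := by rw [integral_const_mul]; ring
  have h0 : Filter.Tendsto (fun ε : ℝ => ε * ((2 * (2 * M + 1)) * ∫ g, ‖v g‖ ∂μ))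
      (𝓝[>] 0) (𝓝 (0 * ((2 * (2 * M + 1)) * ∫ g, ‖v g‖ ∂μ))) :=
    ((continuous_id.mul continuous_const).tendsto 0).mono_left nhdsWithin_le_nhds
  rw [zero_mul] at h0
  refine norm_le_zero_iff.1 (ge_of_tendsto h0 ?_)
  filter_upwards [Ioc_mem_nhdsGT one_pos] with ε hε using main ε hε.1 hε.2

/-- Take a linear functional nonzero on the image of `X` in the chart at `1`, and cut off the
corresponding coordinate function. -/
theorem exists_isTestFunction_mfderiv_one_ne_zero {X : GroupLieAlgebra I G} (hX : X ≠ 0) :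
    ∃ R : G → ℂ, IsTestFunction I R ∧ mfderiv I 𝓘(ℝ, ℂ) R 1 X ≠ 0 := by
  have : IsManifold I 1 G := .of_le (n := ∞) (by simp)
  set A : E →L[ℝ] E := mfderiv I 𝓘(ℝ, E) (extChartAt I (1 : G)) 1 with hA
  have hAi : A.IsInvertible := isInvertible_mfderiv_extChartAt (mem_extChartAt_source (1 : G))
  have hAX : A X ≠ 0 := by
    obtain ⟨e, he⟩ := hAi
    rw [← he]
    exact (map_ne_zero_iff _ e.injective).2 hX
  obtain ⟨l, hl⟩ := SeparatingDual.exists_ne_zero (R := ℝ) hAX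
  obtain ⟨f⟩ : Nonempty (SmoothBumpFunction I (1 : G)) := inferInstance
  set L : E →L[ℝ] ℂ := Complex.ofRealCLM ∘L l with hL
  have hc : ContMDiffOn I 𝓘(ℝ, ℂ) ∞ (fun x => L (extChartAt I (1 : G) x)) (chartAt H (1 : G)).source :=
    L.contMDiff.comp_contMDiffOn contMDiffOn_extChartAt
  refine ⟨fun x => f x • L (extChartAt I (1 : G) x),
    ⟨f.contMDiff_smul hc, f.hasCompactSupport.smul_right⟩, ?_⟩
  have heq : (fun x => f x • L (extChartAt I (1 : G) x)) =ᶠ[𝓝 1]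
      L ∘ extChartAt I (1 : G) := by
    filter_upwards [f.eventuallyEq_one] with x hx
    simp [hx]
  have hcomp := mfderiv_comp (I' := 𝓘(ℝ, E)) (I'' := 𝓘(ℝ, ℂ)) (1 : G) (g := L)
    (f := extChartAt I (1 : G)) L.differentiableAt.mdifferentiableAt
    (mdifferentiableAt_extChartAt (mem_chart_source H 1))
  rw [mfderiv_eq_fderiv, L.fderiv] at hcomp
  rw [heq.mfderiv_eq, hcomp]
  change L (A X) ≠ 0
  simpa [hL] using hl

theorem exists_isTestFunction_lieDeriv_ne_zero {X : GroupLieAlgebra I G} (hX : X ≠ 0) (g : G) :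
    ∃ R : G → ℂ, IsTestFunction I R ∧ lieDeriv I X R g ≠ 0 := by
  obtain ⟨R, hR, hRX⟩ := exists_isTestFunction_mfderiv_one_ne_zero hX
  have hs : ContMDiff I 𝓘(ℝ, ℂ) ∞ fun x => R (g⁻¹ * x) := hR.1.comp contMDiff_mul_left
  refine ⟨fun x => R (g⁻¹ * x), ⟨hs, hR.2.comp_homeomorph (Homeomorph.mulLeft g⁻¹)⟩, ?_⟩
  rw [lieDeriv_eq_mfderiv_comp_mul_left X (hs.mdifferentiable (by simp))]
  have h : ∀ R' : G → ℂ, R' = R → mfderiv I 𝓘(ℝ, ℂ) R' 1 X ≠ 0 := by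
    rintro _ rfl
    exact hRX
  exact h _ (by ext; simp)

/-- The Wronskian is skew, so moving a factor `R` from one argument to the other isolates `∂R` and
removes the derivatives of `P` and `Q`; then `P` is arbitrary. -/
theorem ae_eq_zero_of_integral_wronskian_mul_eq_zero {X : GroupLieAlgebra I G} (hX : X ≠ 0)
    {v : G → ℂ} (hv : Integrable v μ)
    (h : ∀ P Q : G → ℂ, IsTestFunction I P → IsTestFunction I Q →
      ∫ g, wronskian X P Q g * v g ∂μ = 0) : ∀ᵐ g ∂μ, v g = 0 := by
  have key : ∀ Q R : G → ℂ, IsTestFunction I Q → IsTestFunction I R →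
      ∀ᵐ g ∂μ, Q g * lieDeriv I X R g * v g = 0 := by
    intro Q R hQ hR
    obtain ⟨M, hM⟩ := hQ.exists_bound X
    obtain ⟨M', hM'⟩ := hR.exists_bound X
    have hint : Integrable (fun g => Q g * lieDeriv I X R g * v g) μ := by
      refine hv.bdd_mul (c := M * M')
        (hQ.1.continuous.mul (continuous_lieDeriv X hR.1)).aestronglyMeasurable
        (.of_forall fun g => ?_)
      rw [norm_mul]
      exact mul_le_mul (hM g).1 (hM' g).2 (norm_nonneg _) ((norm_nonneg _).trans (hM g).1)
    refine ae_eq_zero_of_integral_contMDiff_smul_eq_zero I hint.locallyIntegrable fun P hP hPc => ?_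
    have hP' := IsTestFunction.ofReal hP hPc
    -- These two cases give `W(PR,Q) - W(P,QR) = 2PQ ∂R` integrated against `v`.
    have e1 := h _ _ (hP'.mul hR) hQ
    have e2 := h _ _ hP' (hQ.mul hR)
    have hsub := integral_sub (integrable_wronskian_mul X hv (hP'.mul hR) hQ)
      (integrable_wronskian_mul X hv hP' (hQ.mul hR))
    rw [e1, e2, sub_zero] at hsub
    have d : ∀ {p : G → ℂ}, IsTestFunction I p → MDifferentiable I 𝓘(ℝ, ℂ) p := fun hp =>
      hp.1.mdifferentiable (by simp)
    have hpt : ∀ g, wronskian X (fun x => (P x : ℂ) * R x) Q g * v g -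
        wronskian X (fun x => (P x : ℂ)) (fun x => Q x * R x) g * v g =
        2 * (P g • (Q g * lieDeriv I X R g * v g)) := by
      intro g
      rw [wronskian, wronskian, lieDeriv_mul X (d hP') (d hR), lieDeriv_mul X (d hQ) (d hR),
        Complex.real_smul]
      ring
    simp_rw [hpt] at hsub
    rw [integral_const_mul] at hsub
    exact (mul_eq_zero.1 hsub).resolve_left two_ne_zero
  refine measure_null_of_locally_null _ fun g _ => ?_
  obtain ⟨R, hR, hRg⟩ := exists_isTestFunction_lieDeriv_ne_zero hX g
  obtain ⟨f⟩ : Nonempty (SmoothBumpFunction I g) := inferInstance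
  have hQ := IsTestFunction.ofReal f.contMDiff f.hasCompactSupport
  -- Near `g` both `∂R` and the bump `Q = f` are nonzero, so `Q (∂R) v = 0` forces `v = 0` there.
  refine ⟨{x | ¬ v x = 0} ∩ {x | lieDeriv I X R x ≠ 0 ∧ f x = 1}, Filter.inter_mem
    self_mem_nhdsWithin (mem_nhdsWithin_of_mem_nhds (Filter.inter_mem
      ((continuous_lieDeriv X hR.1).continuousAt.eventually_ne hRg) f.eventuallyEq_one)), ?_⟩
  refine measure_mono_null (fun x hx => ?_) (key _ R hQ hR)
  obtain ⟨h1, h2, h3⟩ := hx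
  change ¬ _
  simpa [h3, h2] using h1

end Wronskian

/-! ### The anti-diagonal is not a set of local synthesis. -/

theorem mainTheorem6
    {E : Type*} [NormedAddCommGroup E] [NormedSpace ℝ E] [FiniteDimensional ℝ E]
    {G : Type*} [TopologicalSpace G] [T2Space G] [LocallyCompactSpace G] [SecondCountableTopology G]
    [ConnectedSpace G]
    [ChartedSpace E G] [Group G] [IsTopologicalGroup G] [LieGroup 𝓘(ℝ, E) ∞ G]
    [MeasurableSpace G] [BorelSpace G]
    (μ : Measure G) [μ.IsHaarMeasure]
    (X : GroupLieAlgebra 𝓘(ℝ, E) G) (hX : X ≠ 0)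
    (v : Lp ℂ 1 μ) (hv : v ≠ 0)
    (hS : ∃ S ∈ groupVN (μ.prod μ),
      ∀ u : G × G → ℂ, IsTestFunction (𝓘(ℝ, E).prod 𝓘(ℝ, E)) u →
        ∀ ξ η : L2 (μ.prod μ), u = coefficient ξ η →
          inner ℂ η (S ξ) =
            ∫ g, lieDeriv (𝓘(ℝ, E).prod 𝓘(ℝ, E)) (lieInl 𝓘(ℝ, E) X) u (g, g⁻¹) * v g ∂μ) :
    ¬ IsLocalSynthesisSet (μ.prod μ) (antidiagonalSet G) := by
  intro hsyn
  obtain ⟨S, hSvn, hS⟩ := hS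
  have hclosed : IsClosed (antidiagonalSet G) := by
    have : antidiagonalSet G = {x : G × G | x.1 * x.2 = 1} := by
      ext ⟨a, b⟩
      simp [antidiagonalSet, mul_eq_one_iff_inv_eq]
    rw [this]
    exact isClosed_eq (continuous_fst.mul continuous_snd) continuous_const
  have hsmall : ∀ ξ η : L2 (μ.prod μ), coefficient ξ η ∈ smallIdeal (μ.prod μ) (antidiagonalSet G) →
      inner ℂ η (S ξ) = 0 := by
    intro ξ η hu
    refine inner_eq_zero_of_mem_smallIdeal (𝓘(ℝ, E).prod 𝓘(ℝ, E)) hclosed S ?_ hu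
    intro ξ η hu hd
    rw [hS _ hu ξ η rfl]
    refine integral_eq_zero_of_ae (.of_forall fun g => ?_)
    have : lieDeriv (𝓘(ℝ, E).prod 𝓘(ℝ, E)) (lieInl 𝓘(ℝ, E) X) (coefficient ξ η) (g, g⁻¹) = 0 :=
      lieDeriv_eq_zero_of_notMem_tsupport _ fun h => hd.subset ⟨h, g, rfl⟩
    simp [this]
  refine hv ((Lp.eq_zero_iff_ae_eq_zero).2 ?_)
  have hvi := L1.integrable_coeFn v
  refine ae_eq_zero_of_integral_wronskian_mul_eq_zero hX hvi fun P Q hP hQ =>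
    integral_wronskian_mul_eq_zero X hvi hP hQ fun φ hφ hφc => ?_
  obtain ⟨hw, hd⟩ := lieDeriv_lieInl_wedge X (contMDiff_smear μ hφ hφc hP.1)
    (contMDiff_smear μ hφ hφc hQ.1)
  have hA := wedge_smear_mem_fourierAc μ hφ hφc hP.1.continuous hP.2 hQ.1.continuous hQ.2
  obtain ⟨ξ, η, hξη⟩ := hA.1
  have h0 := inner_eq_zero_of_isLocalSynthesisSet hsyn hSvn hsmall (ξ := ξ) (η := η) (hξη ▸ hA)
    fun x hx => hξη ▸ wedge_antidiagonal _ _ hx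
  rw [hS _ ⟨hw, hA.2⟩ ξ η hξη] at h0
  simpa only [hd] using h0
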